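/- Let $\mathscr{A}$ be a unital $C^\ast$-algebra with a faithful tracial state $\varphi$ (for example a $\mathrm{II}_1$-factor with its trace, or the von Neumann algebra generated by $c$ below). For $p\ge 2$ let $L^p(\mathscr{A},\varphi)$ be the completion of $\mathscr{A}$ in the norm $\|x\|_p=\varphi(|x|^p)^{1/p}$, regarded as a subspace of $L^2(\mathscr{A},\varphi)$; put $\|\xi\|_p=\infty$ for $\xi\in L^2(\mathscr{A},\varphi)\setminus L^p(\mathscr{A},\varphi)$. Let $c\in\mathscr{A}$ be a circular element, i.e. $c=(s+is')/\sqrt2$ where $s,s'\in\mathscr{A}$ are self-adjoint and free (all their mixed free cumulants with respect to $\varphi$ vanish), each with the semicircle law $\frac1{2\pi}\sqrt{4-x^2}\,dx$ on $[-2,2]$ as its distribution. Let $L^2_{hol}(c)\subset L^2(\mathscr{A},\varphi)$ be the closure of the unital (non-$\ast$) algebra generated by $c$. For every $t\ge 0$ there is a unique bounded linear operator $D_t$ on $L^2_{hol}(c)$ with $D_t(c^n)=e^{-nt}c^n$ for all integers $n\ge 0$ (the dilation semigroup of $c$). For each even integer $p\ge 4$ there are constants $\alpha_p,\beta_p>0$,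 depending only on $p$, such that for all $0<t<1$ and all $T\in L^2_{hol}(c)$ \[ \|D_t T\|_p\le \beta_p\,t^{-1+\frac2p}\,\|T\|_2 \] (in particular $D_tT\in L^p(\mathscr{A},\varphi)$), and \[ \alpha_p\,t^{-1+\frac2p}\;\le\;\|D_t\colon L^2_{hol}(c)\to L^p(\mathscr{A},\varphi)\|\;\le\;\beta_p\,t^{-1+\frac2p}. \] -/

import Mathlib

open scoped ComplexOrder ENNReal Topology

/-! ### Free cumulants, freeness and circular elements -/

section FreeProbability

/-- A partition of `{0, …, n-1}` is non-crossing if there are no `i < j < k < l` with `i, k` in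
one block and `j, l` in a different block. -/
def IsNonCrossing {n : ℕ} (π : Finpartition (Finset.univ : Finset (Fin n))) : Prop :=
  ∀ V ∈ π.parts, ∀ W ∈ π.parts, ∀ i ∈ V, ∀ j ∈ W, ∀ k ∈ V, ∀ l ∈ W,
    i < j → j < k → k < l → V = W

open Classical in
/-- The non-crossing partitions of `{0, …, n-1}` other than the one-block partition. -/
noncomputable def properNonCrossing (n : ℕ) :
    Finset (Finpartition (Finset.univ : Finset (Fin n))) :=
  Finset.univ.filter fun π => IsNonCrossing π ∧ Finset.univ ∉ π.parts

theorem card_lt_of_mem_properNonCrossing {n : ℕ}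
    {π : Finpartition (Finset.univ : Finset (Fin n))} (hπ : π ∈ properNonCrossing n)
    {V : Finset (Fin n)} (hV : V ∈ π.parts) : V.card < n := by
  have h : Finset.univ ∉ π.parts := by
    classical
    exact (Finset.mem_filter.mp hπ).2.2
  have hne : V ≠ Finset.univ := fun e => h (e ▸ hV)
  have := Finset.card_lt_univ_of_notMem
    (Classical.choose_spec (not_forall.mp fun H => hne (Finset.eq_univ_iff_forall.mpr H)))
  simpa using this

/-- The free cumulants `κ_n[a_1, …, a_n]` of a functional `φ`, defined by solving the
moment-cumulant formula `φ (a_1 ⋯ a_n) = ∑_{π ∈ NC(n)} ∏_{V ∈ π} κ_{|V|}[a_i : i ∈ V]`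
(entries of a block in increasing order) recursively for the one-block term. -/
noncomputable def freeCumulant {A : Type*} [Monoid A] (φ : A → ℂ) (n : ℕ) (a : Fin n → A) : ℂ :=
  φ (List.ofFn a).prod -
    ∑ π ∈ (properNonCrossing n).attach, ∏ V ∈ π.1.parts.attach,
      freeCumulant φ V.1.card (fun i => a (V.1.orderEmbOfFin rfl i))
termination_by n
decreasing_by exact card_lt_of_mem_properNonCrossing π.2 V.2

/-- A family is free if all its mixed free cumulants vanish. -/
def IsFreeFamily {A ι : Type*} [Monoid A] (φ : A → ℂ) (a : ι → A) : Prop :=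
  ∀ (n : ℕ) (i : Fin n → ι), (∃ j k, i j ≠ i k) → freeCumulant φ n (fun j => a (i j)) = 0

/-- A (standard) semicircular element: self-adjoint, and its moments are those of the semicircle
law `(2π)⁻¹ √(4 - x²) dx` on `[-2, 2]`. -/
def IsSemicircular {A : Type*} [Monoid A] [Star A] (φ : A → ℂ) (s : A) : Prop :=
  IsSelfAdjoint s ∧
    ∀ n : ℕ, φ (s ^ n) =
      ((∫ x in (-2 : ℝ)..2, x ^ n * (Real.sqrt (4 - x ^ 2) / (2 * Real.pi)) : ℝ) : ℂ)

/-- A circular element: `c = (s + i s') / √2` with `s, s'` free standard semicircular elements. -/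
def IsCircular {A : Type*} [Ring A] [Star A] [Module ℂ A] (φ : A → ℂ) (c : A) : Prop :=
  ∃ s s' : A, IsSemicircular φ s ∧ IsSemicircular φ s' ∧ IsFreeFamily φ ![s, s'] ∧
    c = ((Real.sqrt 2 : ℝ) : ℂ)⁻¹ • (s + Complex.I • s')

end FreeProbability

/-! ### Non-commutative `L^p` norms, the holomorphic space and the dilation semigroup -/

section NoncommutativeLp

variable {A : Type*} [CStarAlgebra A] [PartialOrder A] [StarOrderedRing A]

/-- A positive linear functional that is a faithful tracial state. -/
structure IsFaithfulTracialState (φ : A →ₚ[ℂ] ℂ) : Prop where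
  map_one : φ 1 = 1
  tracial : ∀ x y : A, φ (x * y) = φ (y * x)
  faithful : ∀ x : A, φ (star x * x) = 0 → x = 0

/-- The inclusion of `A` in `L²(A, φ)`, the completion of `A` for the inner product
`⟪x, y⟫ = φ (x⋆ y)`. -/
noncomputable def toL2 (φ : A →ₚ[ℂ] ℂ) : A →ₗ[ℂ] φ.GNS :=
  (UniformSpace.Completion.toComplL (𝕜 := ℂ) (E := φ.PreGNS)).toLinearMap ∘ₗ
    φ.toPreGNS.toLinearMap

/-- `‖x‖_p = φ (|x|^p)^(1/p)` for `x ∈ A`, where `|x| = (x⋆ x)^(1/2)`. -/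
noncomputable def traceNorm (φ : A →ₚ[ℂ] ℂ) (p : ℕ) (x : A) : ℝ :=
  (φ (CFC.abs x ^ p)).re ^ (1 / (p : ℝ))

/-- `ξ ∈ L²(A, φ)` belongs to `L^p(A, φ)`, the completion of `A` for `‖·‖_p` (`p ≥ 2`), and has
norm `r` there: `ξ` is the `L²`-limit of a `‖·‖_p`-Cauchy sequence in `A` whose `p`-norms converge
to `r`. -/
def HasLpNorm (φ : A →ₚ[ℂ] ℂ) (p : ℕ) (ξ : φ.GNS) (r : ℝ) : Prop :=
  ∃ x : ℕ → A,
    Filter.Tendsto (fun n => toL2 φ (x n)) Filter.atTop (𝓝 ξ) ∧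
    (∀ ε : ℝ, 0 < ε → ∃ N, ∀ m, N ≤ m → ∀ n, N ≤ n → traceNorm φ p (x m - x n) < ε) ∧
    Filter.Tendsto (fun n => traceNorm φ p (x n)) Filter.atTop (𝓝 r)

/-- The `L^p`-norm of `ξ ∈ L²(A, φ)`, with value `∞` when `ξ ∉ L^p(A, φ)`. -/
noncomputable def ncLpNorm (φ : A →ₚ[ℂ] ℂ) (p : ℕ) (ξ : φ.GNS) : ℝ≥0∞ :=
  ⨅ (r : ℝ) (_ : HasLpNorm φ p ξ r), ENNReal.ofReal r

/-- `L²_hol(c)`: the closure in `L²(A, φ)` of the unital (non-`⋆`) algebra generated by `c`. -/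
noncomputable def L2hol (φ : A →ₚ[ℂ] ℂ) (c : A) : Submodule ℂ φ.GNS :=
  ((Subalgebra.toSubmodule (Algebra.adjoin ℂ {c})).map (toL2 φ)).topologicalClosure

/-- The power `c ^ n` as a vector of `L²_hol(c)`. -/
noncomputable def holPow (φ : A →ₚ[ℂ] ℂ) (c : A) (n : ℕ) : L2hol φ c :=
  ⟨toL2 φ (c ^ n), Submodule.le_topologicalClosure _
    (Submodule.mem_map_of_mem (pow_mem (Algebra.self_mem_adjoin_singleton ℂ c) n))⟩

/-- `D` is the time-`t` dilation operator of `c`: the bounded operator on `L²_hol(c)` with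
`D (c ^ n) = e^{-nt} c ^ n` for all `n`. -/
def IsDilation (φ : A →ₚ[ℂ] ℂ) (c : A) (t : ℝ) (D : L2hol φ c →L[ℂ] L2hol φ c) : Prop :=
  ∀ n : ℕ, D (holPow φ c n) = ((Real.exp (-(n * t)) : ℝ) : ℂ) • holPow φ c n

/-- The operator norm `‖D : L²_hol(c) → L^p(A, φ)‖ = sup {‖D T‖_p : ‖T‖_2 ≤ 1}`. -/
noncomputable def normL2holLp (φ : A →ₚ[ℂ] ℂ) (c : A) (p : ℕ)
    (D : L2hol φ c →L[ℂ] L2hol φ c) : ℝ≥0∞ :=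
  ⨆ (T : L2hol φ c) (_ : ‖T‖ ≤ 1), ncLpNorm φ p (D T : φ.GNS)

end NoncommutativeLp

/-!
The `⋆`-moments of a circular element `c` count non-crossing pairings of words in `c` and `c⋆`. The
moment-cumulant formula gives this first for words in the two free semicircular elements
(`moment_word`), because their only non-zero cumulants are `κ₂[s, s] = κ₂[s', s'] = 1`. Removing the
pair of the first point (`card_ncPairings`) turns the count into a recursion: the first letter is
contracted with each letter `y` of the word in turn, which costs the covariance of the two letters
and splits the word into the letters before and after `y`. In this form the statement is multilinear
in the letters, hence holds for all letters in the span of `s` and `s'`, in particular for `c` and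
`c⋆` (`apply_word_cons`). Only this recursion and the trace property, collected in
`IsCircularMoment`, are used afterwards.

Upper bound. Let `p = 2 m` and `x = ∑ bₙ cⁿ` with `bₙ = e^{-nt} aₙ`. Expanding `φ ((x x⋆)^m)` gives a
sum over exponents `n₁, k₁, …, nₘ, kₘ` of products of coefficients with the moments of
`c^{n₁} c⋆^{k₁} ⋯ c^{nₘ} c⋆^{kₘ}`. All moments are non-negative, so that the arithmetic-geometric mean
inequality separates the `n`s from the `k`s and bounds the sum by the one with weights `∏ |bₙᵢ|²`.
The triangle inequality for homogeneous components would lose a power of `t` here. For fixed `nᵢ` the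
sum of the moments over all `kᵢ` is `O ((1 + ∑ nᵢ)^{2 (m - 1)})` (`exists_runSum_le`; induction on `m`
and `n₁`, contracting the first letter and rotating the words), and `e^{-2t ∑ nᵢ}` turns this into
`t^{-2 (m - 1)}`. The bound passes from polynomials to `L²_hol(c)` along the partial sums of the
orthogonal expansion in the powers of `c` (`ncLpNorm_dilation_le`).

Lower bound. Let `y = 1 + c + ⋯ + c^{3L - 1}` with `L` close to `1 / t`, the dilation of a vector of
norm `O (L^{1/2})`. Then `φ (y y⋆) = 3 L`, a count of pairings of words with four runs gives
`φ ((y y⋆)²) ≥ L⁴`, and the log-convexity of the moments of `y y⋆` gives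
`φ ((y y⋆)^m) ≥ 3 L (L³ / 3)^{m - 1}`, which has the right order. That the `L^p`-norm of an element of
`A`, computed along any sequence converging in `L²`, is at least its `p`-norm follows from Klein's
inequality for traces of powers (`klein_pow`, `traceNorm_le_of_hasLpNorm`).
-/

/-! ### Moments of the semicircle law -/

/-- The `n`-th moment of the semicircle law on `[-2, 2]`. -/
noncomputable def semicircleMoment (n : ℕ) : ℝ :=
  ∫ x in (-2 : ℝ)..2, x ^ n * (Real.sqrt (4 - x ^ 2) / (2 * Real.pi))

theorem semicircleMoment_zero : semicircleMoment 0 = 1 := by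
  have h := intervalIntegral.integral_comp_mul_left (a := -1) (b := 1)
    (fun x : ℝ => Real.sqrt (4 - x ^ 2)) (c := 2) (by norm_num)
  have h2 : ∀ x : ℝ, Real.sqrt (4 - (2 * x) ^ 2) = 2 * Real.sqrt (1 - x ^ 2) := by
    intro x
    rw [show 4 - (2 * x) ^ 2 = 2 ^ 2 * (1 - x ^ 2) by ring, Real.sqrt_mul (by positivity),
      Real.sqrt_sq (by norm_num)]
  simp only [h2, intervalIntegral.integral_const_mul, integral_sqrt_one_sub_sq] at h
  have h3 : ∫ x in (-2 : ℝ)..2, Real.sqrt (4 - x ^ 2) = 2 * Real.pi := by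
    norm_num at h
    linarith
  simp only [semicircleMoment, pow_zero, one_mul, intervalIntegral.integral_div, h3]
  field_simp

theorem semicircleMoment_odd {n : ℕ} (hn : Odd n) : semicircleMoment n = 0 := by
  have h := intervalIntegral.integral_comp_neg (a := -2) (b := 2)
    (fun x : ℝ => x ^ n * (Real.sqrt (4 - x ^ 2) / (2 * Real.pi)))
  simp only [hn.neg_pow, neg_mul, even_two.neg_pow, intervalIntegral.integral_neg, neg_neg] at h
  unfold semicircleMoment
  linarith

theorem semicircleMoment_add_two (n : ℕ) :
    (n + 4) * semicircleMoment (n + 2) = 4 * (n + 1) * semicircleMoment n := by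
  have hint : ∀ k : ℕ, IntervalIntegrable (fun x : ℝ => x ^ k * Real.sqrt (4 - x ^ 2))
      MeasureTheory.volume (-2) 2 := fun k => by
    apply Continuous.intervalIntegrable; fun_prop
  -- the antiderivative `x ^ (n + 1) * (4 - x ^ 2) ^ (3 / 2)` vanishes at both endpoints
  have h := intervalIntegral.integral_eq_sub_of_hasDerivAt_of_le (a := (-2 : ℝ)) (b := 2)
    (f := fun x : ℝ => x ^ (n + 1) * ((4 - x ^ 2) * Real.sqrt (4 - x ^ 2)))
    (f' := fun x : ℝ => 4 * (n + 1) * (x ^ n * Real.sqrt (4 - x ^ 2)) -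
      (n + 4) * (x ^ (n + 2) * Real.sqrt (4 - x ^ 2))) (by norm_num) (by fun_prop)
    (by
      intro x hx
      have hpos : 0 < 4 - x ^ 2 := by nlinarith [hx.1, hx.2]
      have h1 : HasDerivAt (fun x : ℝ => 4 - x ^ 2) (-(2 * x)) x := by
        simpa using ((hasDerivAt_id x).pow 2).const_sub 4
      have h2 := (h1.mul (h1.sqrt hpos.ne'))
      have h3 := (hasDerivAt_pow (n + 1) x).mul h2
      refine h3.congr_deriv ?_
      have hs : Real.sqrt (4 - x ^ 2) ≠ 0 := (Real.sqrt_pos.2 hpos).ne'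
      have hs2 : Real.sqrt (4 - x ^ 2) ^ 2 = 4 - x ^ 2 := Real.sq_sqrt hpos.le
      simp only [Pi.mul_apply, Nat.add_sub_cancel]
      push_cast
      field_simp
      rw [hs2]
      ring)
    (((hint n).const_mul _).sub ((hint (n + 2)).const_mul _))
  rw [intervalIntegral.integral_sub ((hint n).const_mul _) ((hint (n + 2)).const_mul _),
    intervalIntegral.integral_const_mul, intervalIntegral.integral_const_mul] at h
  norm_num at h
  have hm : ∀ k, semicircleMoment k =
      (∫ x in (-2 : ℝ)..2, x ^ k * Real.sqrt (4 - x ^ 2)) / (2 * Real.pi) := by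
    intro k
    rw [semicircleMoment, ← intervalIntegral.integral_div]
    simp only [mul_div_assoc]
  rw [hm, hm, ← mul_div_assoc, ← mul_div_assoc]
  congr 1
  linarith

theorem semicircleMoment_two_mul (n : ℕ) : semicircleMoment (2 * n) = catalan n := by
  induction n with
  | zero => simp [semicircleMoment_zero]
  | succ n ih =>
    have h := semicircleMoment_add_two (2 * n)
    rw [ih] at h
    have h1 : ((n + 1 : ℕ) : ℝ) * catalan n = n.centralBinom := by
      exact_mod_cast succ_mul_catalan_eq_centralBinom n
    have h2 : ((n + 2 : ℕ) : ℝ) * catalan (n + 1) = (n + 1).centralBinom := by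
      exact_mod_cast succ_mul_catalan_eq_centralBinom (n + 1)
    have h3 : ((n + 1 : ℕ) : ℝ) * (n + 1).centralBinom = 2 * (2 * n + 1) * n.centralBinom := by
      exact_mod_cast Nat.succ_mul_centralBinom_succ n
    rw [← h1, ← h2] at h3
    push_cast at h h3
    have h4 : ((n : ℝ) + 2) * catalan (n + 1) = 2 * (2 * n + 1) * catalan n := by
      apply mul_left_cancel₀ (show ((n : ℝ) + 1) ≠ 0 by positivity)
      linarith
    rw [show 2 * (n + 1) = 2 * n + 2 by ring]
    apply mul_left_cancel₀ (show ((n : ℝ) + 2) ≠ 0 by positivity)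
    linarith

/-- The moments of the semicircle law satisfy the recursion obtained by removing the block of the
first point from a non-crossing pairing. -/
theorem semicircleMoment_recursion (n : ℕ) :
    semicircleMoment (n + 2) =
      ∑ j ∈ Finset.range (n + 1), semicircleMoment j * semicircleMoment (n - j) := by
  rcases Nat.even_or_odd' n with ⟨k, rfl | rfl⟩
  · rw [show 2 * k + 2 = 2 * (k + 1) by ring, semicircleMoment_two_mul, catalan_succ]
    push_cast
    rw [← Finset.sum_range fun i => (catalan i : ℝ) * catalan (k - i)]
    refine Finset.sum_of_injOn (fun i => 2 * i) (fun i _ j _ h => by simpa using h)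
      (fun i hi => by simp at hi ⊢; omega) (fun j hj hj' => ?_) (fun i hi => ?_)
    · rcases Nat.even_or_odd' j with ⟨i, rfl | h⟩
      · exact absurd ⟨i, by simp at hj ⊢; omega, rfl⟩ hj'
      · rw [semicircleMoment_odd ⟨i, h⟩, zero_mul]
    · rw [← Nat.mul_sub, semicircleMoment_two_mul, semicircleMoment_two_mul]
  · rw [semicircleMoment_odd ⟨k + 1, by ring⟩, Finset.sum_eq_zero]
    intro j hj
    rw [Finset.mem_range] at hj
    rcases Nat.even_or_odd j with h | h
    · rw [semicircleMoment_odd (n := 2 * k + 1 - j), mul_zero]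
      grind
    · rw [semicircleMoment_odd h, zero_mul]

/-! ### Non-crossing pairings of intervals -/

/-- `P` is a non-crossing pairing of the interval `[a, d)`, each pair listed with its smaller
element first, all of whose pairs are monochromatic for the colouring `g`. -/
structure IsNCPairing {ι : Type*} (g : ℕ → ι) (a d : ℕ) (P : Finset (ℕ × ℕ)) : Prop where
  bounds : ∀ e ∈ P, a ≤ e.1 ∧ e.1 < e.2 ∧ e.2 < d
  color : ∀ e ∈ P, g e.1 = g e.2
  cover : ∀ x, a ≤ x → x < d → ∃ e ∈ P, x = e.1 ∨ x = e.2
  disjoint : ∀ e ∈ P, ∀ f ∈ P, (e.1 = f.1 ∨ e.1 = f.2 ∨ e.2 = f.1 ∨ e.2 = f.2) → e = f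
  noncrossing : ∀ e ∈ P, ∀ f ∈ P, ¬ (e.1 < f.1 ∧ f.1 < e.2 ∧ e.2 < f.2)

open Classical in
/-- The monochromatic non-crossing pairings of the interval `[a, d)`. -/
noncomputable def ncPairings {ι : Type*} (g : ℕ → ι) (a d : ℕ) : Finset (Finset (ℕ × ℕ)) :=
  (Finset.Ico a d ×ˢ Finset.Ico a d).powerset.filter (IsNCPairing g a d)

theorem mem_ncPairings {ι : Type*} {g : ℕ → ι} {a d : ℕ} {P : Finset (ℕ × ℕ)} :
    P ∈ ncPairings g a d ↔ IsNCPairing g a d P := by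
  classical
  rw [ncPairings, Finset.mem_filter, Finset.mem_powerset, and_iff_right_iff_imp]
  intro h e he
  have := h.bounds e he
  simp only [Finset.mem_product, Finset.mem_Ico]
  omega

theorem ncPairings_self {ι : Type*} (g : ℕ → ι) (a : ℕ) : ncPairings g a a = {∅} := by
  ext P
  rw [mem_ncPairings, Finset.mem_singleton]
  constructor
  · intro h
    refine Finset.eq_empty_of_forall_notMem fun e he => ?_
    have := h.bounds e he
    omega
  · rintro rfl
    constructor <;> simp

theorem IsNCPairing.exists_first {ι : Type*} {g : ℕ → ι} {a d : ℕ} {P : Finset (ℕ × ℕ)}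
    (h : IsNCPairing g a d P) (had : a < d) : ∃ b, (a, b) ∈ P := by
  obtain ⟨e, he, hx⟩ := h.cover a le_rfl had
  have := h.bounds e he
  have : e.1 = a := by omega
  exact ⟨e.2, by rw [← this]; exact he⟩

/-- The pairs other than the pair `(a, b)` of the first point lie inside or outside of it. -/
theorem IsNCPairing.dichotomy {ι : Type*} {g : ℕ → ι} {a b d : ℕ} {P : Finset (ℕ × ℕ)}
    (h : IsNCPairing g a d P) (hab : (a, b) ∈ P) {e : ℕ × ℕ} (he : e ∈ P) (hne : e ≠ (a, b)) :
    (a < e.1 ∧ e.2 < b) ∨ b < e.1 := by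
  have h1 := h.bounds e he
  have h2 := h.bounds _ hab
  have h3 := h.disjoint e he _ hab
  have h4 := h.noncrossing _ hab e he
  by_contra hc
  apply hne
  apply h3
  simp only at *
  omega

theorem IsNCPairing.inside {ι : Type*} {g : ℕ → ι} {a b d : ℕ} {P : Finset (ℕ × ℕ)}
    (h : IsNCPairing g a d P) (hab : (a, b) ∈ P) :
    IsNCPairing g (a + 1) b (P.filter fun e => a < e.1 ∧ e.2 < b) := by
  constructor
  · intro e he
    have := h.bounds e (Finset.mem_filter.1 he).1
    have := (Finset.mem_filter.1 he).2
    omega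
  · intro e he
    exact h.color e (Finset.mem_filter.1 he).1
  · intro x hx hxb
    have h2 := h.bounds _ hab
    obtain ⟨e, he, hxe⟩ := h.cover x (by omega) (by simp only at h2; omega)
    refine ⟨e, Finset.mem_filter.2 ⟨he, ?_⟩, hxe⟩
    have h3 := h.bounds e he
    rcases eq_or_ne e (a, b) with rfl | hne
    · simp only at *; omega
    · rcases h.dichotomy hab he hne with h4 | h4
      · exact h4
      · omega
  · intro e he f hf
    exact h.disjoint e (Finset.mem_filter.1 he).1 f (Finset.mem_filter.1 hf).1
  · intro e he f hf
    exact h.noncrossing e (Finset.mem_filter.1 he).1 f (Finset.mem_filter.1 hf).1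

theorem IsNCPairing.outside {ι : Type*} {g : ℕ → ι} {a b d : ℕ} {P : Finset (ℕ × ℕ)}
    (h : IsNCPairing g a d P) (hab : (a, b) ∈ P) :
    IsNCPairing g (b + 1) d (P.filter fun e => b < e.1) := by
  constructor
  · intro e he
    have := h.bounds e (Finset.mem_filter.1 he).1
    have := (Finset.mem_filter.1 he).2
    omega
  · intro e he
    exact h.color e (Finset.mem_filter.1 he).1
  · intro x hx hxd
    have h2 := h.bounds _ hab
    obtain ⟨e, he, hxe⟩ := h.cover x (by simp only at h2; omega) hxd
    refine ⟨e, Finset.mem_filter.2 ⟨he, ?_⟩, hxe⟩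
    have h3 := h.bounds e he
    rcases eq_or_ne e (a, b) with rfl | hne
    · simp only at *; omega
    · rcases h.dichotomy hab he hne with h4 | h4
      · omega
      · exact h4
  · intro e he f hf
    exact h.disjoint e (Finset.mem_filter.1 he).1 f (Finset.mem_filter.1 hf).1
  · intro e he f hf
    exact h.noncrossing e (Finset.mem_filter.1 he).1 f (Finset.mem_filter.1 hf).1

theorem IsNCPairing.glue {ι : Type*} {g : ℕ → ι} {a b d : ℕ} {P Q : Finset (ℕ × ℕ)}
    (hab : a < b) (hbd : b < d) (hg : g a = g b)
    (hP : IsNCPairing g (a + 1) b P) (hQ : IsNCPairing g (b + 1) d Q) :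
    IsNCPairing g a d (insert (a, b) (P ∪ Q)) := by
  have mem : ∀ e, e ∈ insert (a, b) (P ∪ Q) ↔ e = (a, b) ∨ e ∈ P ∨ e ∈ Q := by simp
  constructor
  · intro e he
    rcases (mem e).1 he with rfl | he | he
    · exact ⟨le_rfl, hab, hbd⟩
    · have := hP.bounds e he; omega
    · have := hQ.bounds e he; omega
  · intro e he
    rcases (mem e).1 he with rfl | he | he
    · exact hg
    · exact hP.color e he
    · exact hQ.color e he
  · intro x hx hxd
    rcases lt_trichotomy x b with h | h | h
    · rcases hx.eq_or_lt with h' | h'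
      · exact ⟨(a, b), (mem _).2 (Or.inl rfl), Or.inl h'.symm⟩
      · obtain ⟨e, he, h⟩ := hP.cover x h' h
        exact ⟨e, (mem _).2 (Or.inr (Or.inl he)), h⟩
    · exact ⟨(a, b), (mem _).2 (Or.inl rfl), Or.inr h⟩
    · obtain ⟨e, he, h⟩ := hQ.cover x h hxd
      exact ⟨e, (mem _).2 (Or.inr (Or.inr he)), h⟩
  · intro e he f hf hef
    rcases (mem e).1 he with rfl | he | he <;> rcases (mem f).1 hf with rfl | hf | hf
    · rfl
    · have := hP.bounds f hf; simp only at hef; omega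
    · have := hQ.bounds f hf; simp only at hef; omega
    · have := hP.bounds e he; simp only at hef; omega
    · exact hP.disjoint e he f hf hef
    · have := hP.bounds e he; have := hQ.bounds f hf; omega
    · have := hQ.bounds e he; simp only at hef; omega
    · have := hQ.bounds e he; have := hP.bounds f hf; omega
    · exact hQ.disjoint e he f hf hef
  · intro e he f hf
    rcases (mem e).1 he with rfl | he | he <;> rcases (mem f).1 hf with rfl | hf | hf
    · simp
    · have := hP.bounds f hf; simp only; omega
    · have := hQ.bounds f hf; simp only; omega
    · have := hP.bounds e he; simp only; omega
    · exact hP.noncrossing e he f hf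
    · have := hP.bounds e he; have := hQ.bounds f hf; omega
    · have := hQ.bounds e he; simp only; omega
    · have := hQ.bounds e he; have := hP.bounds f hf; omega
    · exact hQ.noncrossing e he f hf

/-- Removing the pair of the first point splits a non-crossing pairing into a pairing of the points
inside that pair and a pairing of the points to its right. -/
theorem card_ncPairings {ι : Type*} [DecidableEq ι] (g : ℕ → ι) {a d : ℕ} (had : a < d) :
    (ncPairings g a d).card = ∑ b ∈ Finset.Ico (a + 1) d,
      if g a = g b then (ncPairings g (a + 1) b).card * (ncPairings g (b + 1) d).card else 0 := by
  classical
  have hU : ncPairings g a d = (Finset.Ico (a + 1) d).biUnion fun b =>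
      (ncPairings g a d).filter fun P => (a, b) ∈ P := by
    ext P
    simp only [Finset.mem_biUnion, Finset.mem_filter, mem_ncPairings]
    constructor
    · intro h
      obtain ⟨b, hb⟩ := h.exists_first had
      have := h.bounds _ hb
      exact ⟨b, by simp only [Finset.mem_Ico] at *; omega, h, hb⟩
    · rintro ⟨b, -, h, -⟩
      exact h
  conv_lhs => rw [hU]
  rw [Finset.card_biUnion]
  · refine Finset.sum_congr rfl fun b hb => ?_
    rw [Finset.mem_Ico] at hb
    split_ifs with hg
    · rw [← Finset.card_product]
      refine Finset.card_nbij'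
        (fun P => (P.filter fun e => a < e.1 ∧ e.2 < b, P.filter fun e => b < e.1))
        (fun Q => insert (a, b) (Q.1 ∪ Q.2)) ?_ ?_ ?_ ?_
      · intro P hP
        simp only [Finset.coe_filter, Set.mem_ofPred_eq, mem_ncPairings] at hP
        simp only [Finset.coe_product, Set.mem_prod, Finset.mem_coe, mem_ncPairings]
        exact ⟨hP.1.inside hP.2, hP.1.outside hP.2⟩
      · intro Q hQ
        simp only [Finset.coe_product, Set.mem_prod, Finset.mem_coe, mem_ncPairings] at hQ
        simp only [Finset.coe_filter, Set.mem_ofPred_eq, mem_ncPairings]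
        exact ⟨IsNCPairing.glue hb.1 hb.2 hg hQ.1 hQ.2, Finset.mem_insert_self _ _⟩
      · intro P hP
        simp only [Finset.coe_filter, Set.mem_ofPred_eq, mem_ncPairings] at hP
        ext e
        simp only [Finset.mem_insert, Finset.mem_union, Finset.mem_filter]
        constructor
        · rintro (rfl | h | h)
          exacts [hP.2, h.1, h.1]
        · intro he
          rcases eq_or_ne e (a, b) with h | h
          · exact Or.inl h
          · exact Or.inr ((hP.1.dichotomy hP.2 he h).imp (⟨he, ·⟩) (⟨he, ·⟩))
      · rintro ⟨Q, R⟩ hQ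
        simp only [Finset.coe_product, Set.mem_prod, Finset.mem_coe, mem_ncPairings] at hQ
        obtain ⟨hQ, hR⟩ := hQ
        simp only [Prod.mk.injEq]
        constructor
        · ext e
          simp only [Finset.mem_filter, Finset.mem_insert, Finset.mem_union]
          constructor
          · rintro ⟨rfl | h | h, h'⟩
            · simp at h'
            · exact h
            · have := hR.bounds e h; omega
          · intro h
            have := hQ.bounds e h
            exact ⟨Or.inr (Or.inl h), by omega⟩
        · ext e
          simp only [Finset.mem_filter, Finset.mem_insert, Finset.mem_union]
          constructor
          · rintro ⟨rfl | h | h, h'⟩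
            · simp only at h'; omega
            · have := hQ.bounds e h; omega
            · exact h
          · intro h
            have := hR.bounds e h
            exact ⟨Or.inr (Or.inr h), by omega⟩
    · rw [Finset.card_eq_zero]
      refine Finset.eq_empty_of_forall_notMem fun P hP => hg ?_
      rw [Finset.mem_filter, mem_ncPairings] at hP
      exact hP.1.color _ hP.2
  · intro b _ b' _ hbb
    refine Finset.disjoint_left.2 fun P hP hP' => hbb ?_
    rw [Finset.mem_filter, mem_ncPairings] at hP hP'
    have := hP.1.disjoint _ hP.2 _ hP'.2 (Or.inl rfl)
    simpa using this

theorem ncPairings_congr {ι κ : Type*} {g : ℕ → ι} {h : ℕ → κ} {a d : ℕ}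
    (hgh : ∀ x y, a ≤ x → x < d → a ≤ y → y < d → (g x = g y ↔ h x = h y)) :
    ncPairings g a d = ncPairings h a d := by
  ext P
  rw [mem_ncPairings, mem_ncPairings]
  constructor
  · rintro ⟨h1, h2, h3, h4, h5⟩
    refine ⟨h1, fun e he => ?_, h3, h4, h5⟩
    have := h1 e he
    exact (hgh _ _ (by omega) (by omega) (by omega) (by omega)).1 (h2 e he)
  · rintro ⟨h1, h2, h3, h4, h5⟩
    refine ⟨h1, fun e he => ?_, h3, h4, h5⟩
    have := h1 e he
    exact (hgh _ _ (by omega) (by omega) (by omega) (by omega)).2 (h2 e he)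

theorem card_ncPairings_const {ι : Type*} (z : ι) (n a : ℕ) :
    ((ncPairings (fun _ => z) a (a + n)).card : ℝ) = semicircleMoment n := by
  classical
  induction n using Nat.strong_induction_on generalizing a with
  | _ n ih =>
    rcases n with _ | _ | n
    · simp [ncPairings_self, semicircleMoment_zero]
    · rw [card_ncPairings _ (by omega), semicircleMoment_odd (by decide)]
      simp
    · rw [card_ncPairings _ (by omega), semicircleMoment_recursion]
      simp only [if_true]
      push_cast
      rw [show a + (n + 1 + 1) = (a + 1) + (n + 1) by ring, Finset.sum_Ico_eq_sum_range]
      simp only [Nat.add_sub_cancel_left]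
      refine Finset.sum_congr rfl fun j hj => ?_
      rw [Finset.mem_range] at hj
      rw [ih j (by omega), ← ih (n - j) (by omega) (a + 1 + j + 1)]
      rw [show a + 1 + (n + 1) = a + 1 + j + 1 + (n - j) by omega]

/-! ### Non-crossing pairings as partitions -/

/-- All blocks of the partition have two elements and are monochromatic for the colouring `g`. -/
def IsPairPartition {ι : Type*} (g : ℕ → ι) {n : ℕ}
    (π : Finpartition (Finset.univ : Finset (Fin n))) : Prop :=
  ∀ V ∈ π.parts, V.card = 2 ∧ ∀ x ∈ V, ∀ y ∈ V, g x = g y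

section PairPartition

variable {ι : Type*} {g : ℕ → ι} {n : ℕ} {π : Finpartition (Finset.univ : Finset (Fin n))}

open Classical in
/-- The pairs `(x, y)` with `x < y` in a common block. -/
noncomputable def blockPairs (π : Finpartition (Finset.univ : Finset (Fin n))) :
    Finset (ℕ × ℕ) :=
  (Finset.univ.filter fun e : Fin n × Fin n => e.1 < e.2 ∧ ∃ V ∈ π.parts, e.1 ∈ V ∧ e.2 ∈ V).image
    fun e => ((e.1 : ℕ), (e.2 : ℕ))

theorem mem_blockPairs {e : ℕ × ℕ} : e ∈ blockPairs π ↔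
    ∃ x y : Fin n, x < y ∧ (∃ V ∈ π.parts, x ∈ V ∧ y ∈ V) ∧ e = (↑x, ↑y) := by
  simp only [blockPairs, Finset.mem_image, Finset.mem_filter, Finset.mem_univ, true_and,
    Prod.exists, and_assoc, eq_comm]

theorem IsPairPartition.exists_pair (h : IsPairPartition g π) {V : Finset (Fin n)}
    (hV : V ∈ π.parts) : ∃ x y, x < y ∧ V = {x, y} := by
  obtain ⟨x, y, hxy, rfl⟩ := Finset.card_eq_two.1 (h V hV).1
  rcases lt_or_gt_of_ne hxy with h | h
  · exact ⟨x, y, h, rfl⟩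
  · exact ⟨y, x, h, Finset.pair_comm _ _⟩

theorem IsPairPartition.eq_pair (h : IsPairPartition g π) {V : Finset (Fin n)}
    (hV : V ∈ π.parts) {x y : Fin n} (hx : x ∈ V) (hy : y ∈ V) (hxy : x < y) : V = {x, y} := by
  symm
  apply Finset.eq_of_subset_of_card_le
  · intro z hz
    rcases Finset.mem_insert.1 hz with rfl | hz
    · exact hx
    · rw [Finset.mem_singleton.1 hz]; exact hy
  · rw [(h V hV).1, Finset.card_pair hxy.ne]

theorem eq_of_mem_parts {V W : Finset (Fin n)} (hV : V ∈ π.parts) (hW : W ∈ π.parts) {x : Fin n}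
    (hxV : x ∈ V) (hxW : x ∈ W) : V = W :=
  (π.existsUnique_mem (Finset.mem_univ x)).unique ⟨hV, hxV⟩ ⟨hW, hxW⟩

theorem IsPairPartition.isNCPairing (h : IsPairPartition g π) (hnc : IsNonCrossing π) :
    IsNCPairing g 0 n (blockPairs π) := by
  constructor
  · intro e he
    obtain ⟨x, y, hxy, -, rfl⟩ := mem_blockPairs.1 he
    exact ⟨Nat.zero_le _, hxy, y.2⟩
  · intro e he
    obtain ⟨x, y, hxy, ⟨V, hV, hx, hy⟩, rfl⟩ := mem_blockPairs.1 he
    exact (h V hV).2 x hx y hy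
  · intro z _ hz
    obtain ⟨V, ⟨hV, hzV⟩, -⟩ := π.existsUnique_mem (Finset.mem_univ (⟨z, hz⟩ : Fin n))
    obtain ⟨x, y, hxy, rfl⟩ := h.exists_pair hV
    refine ⟨(↑x, ↑y), mem_blockPairs.2 ⟨x, y, hxy, ⟨_, hV, by simp, by simp⟩, rfl⟩, ?_⟩
    simpa [Fin.ext_iff] using hzV
  · intro e he f hf hef
    obtain ⟨x, y, hxy, ⟨V, hV, hx, hy⟩, rfl⟩ := mem_blockPairs.1 he
    obtain ⟨z, w, hzw, ⟨W, hW, hz, hw⟩, rfl⟩ := mem_blockPairs.1 hf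
    simp only [← Fin.ext_iff] at hef
    have hVW : V = W := by
      rcases hef with rfl | rfl | rfl | rfl
      exacts [eq_of_mem_parts hV hW hx hz, eq_of_mem_parts hV hW hx hw,
        eq_of_mem_parts hV hW hy hz, eq_of_mem_parts hV hW hy hw]
    subst hVW
    rw [h.eq_pair hV hx hy hxy] at hz hw
    simp only [Finset.mem_insert, Finset.mem_singleton] at hz hw
    rcases hz with rfl | rfl <;> rcases hw with rfl | rfl <;> first | rfl | (exfalso; omega)
  · intro e he f hf
    obtain ⟨x, y, hxy, ⟨V, hV, hx, hy⟩, rfl⟩ := mem_blockPairs.1 he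
    obtain ⟨z, w, hzw, ⟨W, hW, hz, hw⟩, rfl⟩ := mem_blockPairs.1 hf
    simp only [Fin.val_fin_lt]
    rintro ⟨h1, h2, h3⟩
    obtain rfl := hnc V hV W hW x hx z hz y hy w hw h1 h2 h3
    rw [h.eq_pair hV hx hy hxy] at hz
    simp only [Finset.mem_insert, Finset.mem_singleton] at hz
    rcases hz with rfl | rfl
    exacts [lt_irrefl _ h1, lt_irrefl _ h2]

theorem parts_subset_of_blockPairs_subset {π' : Finpartition (Finset.univ : Finset (Fin n))}
    (h : IsPairPartition g π) (h' : IsPairPartition g π') (hP : blockPairs π ⊆ blockPairs π') :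
    π.parts ⊆ π'.parts := by
  intro V hV
  obtain ⟨x, y, hxy, rfl⟩ := h.exists_pair hV
  obtain ⟨z, w, -, ⟨W, hW, hz, hw⟩, he⟩ := mem_blockPairs.1
    (hP (mem_blockPairs.2 ⟨x, y, hxy, ⟨_, hV, by simp, by simp⟩, rfl⟩))
  simp only [Prod.mk.injEq, ← Fin.ext_iff] at he
  obtain ⟨rfl, rfl⟩ := he
  rwa [← h'.eq_pair hW hz hw hxy]

open Classical in
/-- The partition of `Fin n` whose blocks are the pairs of a non-crossing pairing. -/
noncomputable def IsNCPairing.partition {P : Finset (ℕ × ℕ)} (h : IsNCPairing g 0 n P) :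
    Finpartition (Finset.univ : Finset (Fin n)) :=
  Finpartition.ofExistsUnique
    (P.image fun e => Finset.univ.filter fun i : Fin n => (i : ℕ) = e.1 ∨ (i : ℕ) = e.2)
    (fun _ _ => Finset.subset_univ _)
    (by
      intro i _
      obtain ⟨e, he, hi⟩ := h.cover i (Nat.zero_le _) i.2
      refine ⟨_, ⟨Finset.mem_image_of_mem _ he, by simpa using hi⟩, ?_⟩
      rintro W ⟨hW, hiW⟩
      obtain ⟨f, hf, rfl⟩ := Finset.mem_image.1 hW
      simp only [Finset.mem_filter, Finset.mem_univ, true_and] at hiW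
      rw [h.disjoint e he f hf (by omega)])
    (by
      intro hW
      obtain ⟨e, he, hW⟩ := Finset.mem_image.1 hW
      have hb := h.bounds e he
      have : (⟨e.1, by omega⟩ : Fin n) ∈ (∅ : Finset (Fin n)) := by
        rw [← hW]; simp
      simp at this)

theorem IsNCPairing.mem_partition {P : Finset (ℕ × ℕ)} (h : IsNCPairing g 0 n P)
    {V : Finset (Fin n)} : V ∈ h.partition.parts ↔
      ∃ x y : Fin n, ((x : ℕ), (y : ℕ)) ∈ P ∧ V = {x, y} := by
  classical
  simp only [IsNCPairing.partition, Finpartition.ofExistsUnique, Finset.mem_image]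
  constructor
  · rintro ⟨e, he, rfl⟩
    have hb := h.bounds e he
    refine ⟨⟨e.1, by omega⟩, ⟨e.2, hb.2.2⟩, he, ?_⟩
    ext i
    simp [Fin.ext_iff]
  · rintro ⟨x, y, he, rfl⟩
    refine ⟨_, he, ?_⟩
    ext i
    simp [Fin.ext_iff]

theorem IsNCPairing.isPairPartition {P : Finset (ℕ × ℕ)} (h : IsNCPairing g 0 n P) :
    IsPairPartition g h.partition := by
  intro V hV
  obtain ⟨x, y, he, rfl⟩ := h.mem_partition.1 hV
  have hb := h.bounds _ he
  have hc := h.color _ he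
  refine ⟨Finset.card_pair (by rintro rfl; simp at hb), ?_⟩
  intro z hz w hw
  simp only [Finset.mem_insert, Finset.mem_singleton] at hz hw
  rcases hz with rfl | rfl <;> rcases hw with rfl | rfl
  exacts [rfl, hc, hc.symm, rfl]

theorem IsNCPairing.isNonCrossing {P : Finset (ℕ × ℕ)} (h : IsNCPairing g 0 n P) :
    IsNonCrossing h.partition := by
  intro V hV W hW i hi j hj k hk l hl hij hjk hkl
  obtain ⟨x, y, he, rfl⟩ := h.mem_partition.1 hV
  obtain ⟨z, w, hf, rfl⟩ := h.mem_partition.1 hW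
  have hb := h.bounds _ he
  have hb' := h.bounds _ hf
  have hn := h.noncrossing _ he _ hf
  simp only [Finset.mem_insert, Finset.mem_singleton, Fin.ext_iff, Fin.lt_def] at *
  omega

theorem IsNCPairing.blockPairs_partition {P : Finset (ℕ × ℕ)} (h : IsNCPairing g 0 n P) :
    blockPairs h.partition = P := by
  ext e
  rw [mem_blockPairs]
  constructor
  · rintro ⟨x, y, hxy, ⟨V, hV, hx, hy⟩, rfl⟩
    obtain ⟨z, w, hf, rfl⟩ := h.mem_partition.1 hV
    have hb := h.bounds _ hf
    simp only [Finset.mem_insert, Finset.mem_singleton] at hx hy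
    rcases hx with rfl | rfl <;> rcases hy with rfl | rfl
    · exact absurd hxy (lt_irrefl _)
    · exact hf
    · simp only [Fin.lt_def] at *; omega
    · exact absurd hxy (lt_irrefl _)
  · intro he
    have hb := h.bounds e he
    exact ⟨⟨e.1, by omega⟩, ⟨e.2, hb.2.2⟩, hb.2.1,
      ⟨_, h.mem_partition.2 ⟨⟨e.1, by omega⟩, ⟨e.2, hb.2.2⟩, he, rfl⟩, by simp, by simp⟩, rfl⟩

open Classical in
theorem card_pairPartitions (g : ℕ → ι) (n : ℕ) :
    (Finset.univ.filter fun π : Finpartition (Finset.univ : Finset (Fin n)) =>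
      IsNonCrossing π ∧ IsPairPartition g π).card = (ncPairings g 0 n).card := by
  refine Finset.card_bij (fun π _ => blockPairs π) ?_ ?_ ?_
  · intro π hπ
    have := (Finset.mem_filter.1 hπ).2
    exact mem_ncPairings.2 (this.2.isNCPairing this.1)
  · intro π hπ π' hπ' hP
    have h := (Finset.mem_filter.1 hπ).2.2
    have h' := (Finset.mem_filter.1 hπ').2.2
    exact Finpartition.ext (Finset.Subset.antisymm (parts_subset_of_blockPairs_subset h h' hP.subset)
      (parts_subset_of_blockPairs_subset h' h hP.symm.subset))
  · intro P hP
    have h := mem_ncPairings.1 hP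
    exact ⟨h.partition, Finset.mem_filter.2 ⟨Finset.mem_univ _, h.isNonCrossing,
      h.isPairPartition⟩, h.blockPairs_partition⟩

end PairPartition

/-! ### Joint moments of a free pair of semicircular elements -/

section Cumulants

variable {A : Type*} [Monoid A] {φ : A → ℂ}

theorem freeCumulant_eq (φ : A → ℂ) (n : ℕ) (a : Fin n → A) :
    freeCumulant φ n a = φ (List.ofFn a).prod -
      ∑ π ∈ properNonCrossing n, ∏ V ∈ π.parts,
        freeCumulant φ V.card (fun i => a (V.orderEmbOfFin rfl i)) := by
  rw [freeCumulant]
  congr 1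
  rw [← Finset.sum_attach (properNonCrossing n)]
  refine Finset.sum_congr rfl fun π _ => ?_
  rw [← Finset.prod_attach π.1.parts]

open Classical in
/-- The sum over proper non-crossing partitions in the moment-cumulant formula, when the only
non-zero cumulants are those of monochromatic pairs. For `n = 2` the only pairing is the one-block
partition, which is not proper. -/
theorem sum_properNonCrossing_pair {ι : Type*} (g : ℕ → ι) (n : ℕ) :
    (∑ π ∈ properNonCrossing n, ∏ V ∈ π.parts,
      if V.card = 2 ∧ ∀ x ∈ V, ∀ y ∈ V, g x = g y then (1 : ℂ) else 0) =
      if n = 2 then 0 else ((ncPairings g 0 n).card : ℂ) := by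
  simp only [Finset.prod_ite_zero, Finset.prod_const_one]
  rw [← card_pairPartitions g n, ← Finset.sum_filter, Finset.sum_const, nsmul_eq_mul, mul_one]
  split_ifs with hn
  · subst hn
    rw [Nat.cast_eq_zero, Finset.card_eq_zero]
    refine Finset.eq_empty_of_forall_notMem fun π hπ => ?_
    obtain ⟨hπ, hp⟩ := Finset.mem_filter.1 hπ
    obtain ⟨V, ⟨hV, -⟩, -⟩ := π.existsUnique_mem (Finset.mem_univ 0)
    have := card_lt_of_mem_properNonCrossing hπ hV
    have := (hp V hV).1
    omega
  · congr 2
    ext π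
    simp only [properNonCrossing, Finset.mem_filter, Finset.mem_univ, true_and]
    constructor
    · rintro ⟨h1, h2⟩
      exact ⟨h1.1, h2⟩
    · rintro ⟨h1, h2⟩
      refine ⟨⟨h1, fun hu => hn ?_⟩, h2⟩
      simpa using (h2 _ hu).1

theorem freeCumulant_semicircular [Star A] {s : A} (hs : IsSemicircular φ s) (n : ℕ) :
    freeCumulant φ n (fun _ => s) = if n = 2 then 1 else 0 := by
  classical
  induction n using Nat.strong_induction_on with
  | _ n ih =>
    rw [freeCumulant_eq]
    have h1 : (∑ π ∈ properNonCrossing n, ∏ V ∈ π.parts,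
        freeCumulant φ V.card (fun _ => s)) = if n = 2 then 0 else (semicircleMoment n : ℂ) := by
      have h2 := card_ncPairings_const () n 0
      rw [zero_add] at h2
      rw [← h2, Complex.ofReal_natCast, ← sum_properNonCrossing_pair (fun _ => ())]
      refine Finset.sum_congr rfl fun π hπ => Finset.prod_congr rfl fun V hV => ?_
      rw [ih _ (card_lt_of_mem_properNonCrossing hπ hV)]
      simp
    rw [h1, List.ofFn_const, List.prod_replicate, hs.2 n]
    change ((semicircleMoment n : ℝ) : ℂ) - _ = _
    split_ifs with hn
    · subst hn
      rw [show 2 = 2 * 1 by rfl, semicircleMoment_two_mul]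
      simp
    · simp

theorem freeCumulant_semicircular_pair [Star A] {a : Fin 2 → A}
    (ha : ∀ z, IsSemicircular φ (a z)) (hf : IsFreeFamily φ a) (n : ℕ) (i : Fin n → Fin 2) :
    freeCumulant φ n (fun j => a (i j)) = if n = 2 ∧ ∀ x y, i x = i y then 1 else 0 := by
  by_cases hi : ∀ x y, i x = i y
  · obtain ⟨z, hz⟩ : ∃ z, ∀ j, i j = z := by
      rcases n with _ | n
      · exact ⟨0, fun j => j.elim0⟩
      · exact ⟨i 0, fun j => hi _ _⟩
    simp only [hz, freeCumulant_semicircular (ha z)]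
    simp
  · rw [hf n i (by push Not at hi; exact hi), if_neg fun h => hi h.2]

/-- The joint moments of a free pair of semicircular elements count non-crossing pairings. -/
theorem moment_semicircular_pair [Star A] {a : Fin 2 → A}
    (ha : ∀ z, IsSemicircular φ (a z)) (hf : IsFreeFamily φ a) (n : ℕ) (g : ℕ → Fin 2) :
    φ (List.ofFn fun j : Fin n => a (g j)).prod = (ncPairings g 0 n).card := by
  classical
  have h := freeCumulant_eq φ n (fun j : Fin n => a (g j))
  rw [freeCumulant_semicircular_pair ha hf n (fun j => g j), eq_sub_iff_add_eq] at h
  rw [← h]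
  have h1 : (∑ π ∈ properNonCrossing n, ∏ V ∈ π.parts,
      freeCumulant φ V.card (fun i => a (g (V.orderEmbOfFin rfl i)))) =
      if n = 2 then 0 else ((ncPairings g 0 n).card : ℂ) := by
    rw [← sum_properNonCrossing_pair g]
    refine Finset.sum_congr rfl fun π _ => Finset.prod_congr rfl fun V hV => ?_
    rw [freeCumulant_semicircular_pair ha hf _ fun i => g (V.orderEmbOfFin rfl i)]
    have hV : ∀ p : Fin n → Prop, (∀ x ∈ V, p x) ↔ ∀ i, p (V.orderEmbOfFin rfl i) := fun p => by
      rw [← Set.forall_mem_range (f := V.orderEmbOfFin rfl), Finset.range_orderEmbOfFin]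
      rfl
    simp only [hV]
  rw [h1]
  split_ifs with h1 h2 h2
  · obtain ⟨rfl, h1⟩ := h1
    have := h1 0 1
    rw [card_ncPairings _ (by norm_num)]
    simp [ncPairings_self] at this ⊢
    exact this
  · omega
  · subst h2
    have : g 0 ≠ g 1 := fun h => h1 ⟨rfl, fun x y => by fin_cases x <;> fin_cases y <;> simp [h]⟩
    rw [card_ncPairings _ (by norm_num)]
    simp only [zero_add, Nat.Ico_succ_singleton, Finset.sum_singleton, ncPairings_self]
    simp
    intro h; exact absurd h this
  · simp

theorem card_ncPairings_shift {ι : Type*} (g : ℕ → ι) (k n a : ℕ) :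
    (ncPairings g (k + a) (k + a + n)).card =
      (ncPairings (fun x => g (k + x)) a (a + n)).card := by
  classical
  induction n using Nat.strong_induction_on generalizing a with
  | _ n ih =>
    rcases n with _ | n
    · simp [ncPairings_self]
    · rw [card_ncPairings _ (by omega), card_ncPairings _ (by omega),
        show k + a + (n + 1) = k + a + 1 + n by ring, show a + (n + 1) = a + 1 + n by ring,
        Finset.sum_Ico_eq_sum_range, Finset.sum_Ico_eq_sum_range]
      simp only [Nat.add_sub_cancel_left]
      refine Finset.sum_congr rfl fun j hj => ?_
      rw [Finset.mem_range] at hj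
      have h1 := ih j (by omega) (a + 1)
      have h2 := ih (n - j - 1) (by omega) (a + 1 + j + 1)
      rw [show k + (a + 1) = k + a + 1 by ring] at h1
      rw [show k + (a + 1 + j + 1) = k + a + 1 + j + 1 by ring,
        show k + a + 1 + j + 1 + (n - j - 1) = k + a + 1 + n by omega,
        show a + 1 + j + 1 + (n - j - 1) = a + 1 + n by omega] at h2
      rw [h1, h2, show k + (a + 1 + j) = k + a + 1 + j by ring]

theorem moment_word [Star A] {a : Fin 2 → A}
    (ha : ∀ z, IsSemicircular φ (a z)) (hf : IsFreeFamily φ a) (w : List (Fin 2)) :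
    φ (w.map a).prod = (ncPairings (fun x => w.getD x 0) 0 w.length).card := by
  rw [← moment_semicircular_pair ha hf]
  congr 2
  apply List.ext_getElem
  · simp
  · intro i h1 h2
    simp

theorem moment_cons [Star A] {a : Fin 2 → A}
    (ha : ∀ z, IsSemicircular φ (a z)) (hf : IsFreeFamily φ a) (z : Fin 2) (w : List (Fin 2)) :
    φ ((z :: w).map a).prod = ∑ b ∈ Finset.range w.length,
      (if w.getD b 0 = z then 1 else 0) * φ ((w.take b).map a).prod *
        φ ((w.drop (b + 1)).map a).prod := by
  rw [moment_word ha hf, card_ncPairings _ (by simp)]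
  rw [show (z :: w).length = 1 + w.length by simp [add_comm], Finset.sum_Ico_eq_sum_range]
  push_cast
  simp only [Nat.add_sub_cancel_left]
  refine Finset.sum_congr rfl fun b hb => ?_
  rw [Finset.mem_range] at hb
  rw [moment_word ha hf, moment_word ha hf]
  have h1 := card_ncPairings_shift (fun x => (z :: w).getD x 0) 1 b 0
  have h2 := card_ncPairings_shift (fun x => (z :: w).getD x 0) (1 + b + 1) (w.length - (b + 1)) 0
  simp only [add_zero, zero_add] at h1 h2
  rw [show 1 + b + 1 + (w.length - (b + 1)) = 1 + w.length by omega] at h2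
  rw [h1, h2, List.length_take, List.length_drop, min_eq_left hb.le]
  rw [ncPairings_congr (g := fun x => (w.take b).getD x 0) (h := fun x => (z :: w).getD (1 + x) 0),
    ncPairings_congr (g := fun x => (w.drop (b + 1)).getD x 0)
      (h := fun x => (z :: w).getD (1 + b + 1 + x) 0)]
  · simp only [List.getD_cons_zero, add_comm 1 b, List.getD_cons_succ]
    by_cases h : w.getD b 0 = z
    · rw [if_pos h, if_pos h.symm]; simp
    · rw [if_neg h, if_neg (Ne.symm h)]; simp
  · intro x y _ hx _ hy
    simp only [List.getD_eq_getElem?_getD, List.getElem?_drop]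
    rw [show 1 + b + 1 + x = b + 1 + x + 1 by ring, show 1 + b + 1 + y = b + 1 + y + 1 by ring,
      List.getElem?_cons_succ, List.getElem?_cons_succ]
  · intro x y _ hx _ hy
    simp only [List.getD_eq_getElem?_getD, List.getElem?_take, hx, hy, if_true]
    rw [add_comm 1 x, add_comm 1 y, List.getElem?_cons_succ, List.getElem?_cons_succ]

end Cumulants

/-! ### Contraction of the first letter of a word -/

section SchwingerDyson

variable {A : Type*} [CStarAlgebra A] [PartialOrder A] (φ : A →ₚ[ℂ] ℂ)

/-- The sum over the factors `y` of a product `u * y * v` of the terms `φ (x * y) * φ u * φ v`, where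
the factors to the left of the list have already been multiplied into `pre`. -/
noncomputable def pairingSum (x : A) : A → List A → ℂ
  | _, [] => 0
  | pre, y :: l => φ (x * y) * φ pre * φ l.prod + pairingSum x (pre * y) l

variable {φ}

theorem pairingSum_eq_sum (x pre : A) (l : List A) :
    pairingSum φ x pre l = ∑ b ∈ Finset.range l.length,
      φ (x * l.getD b 0) * φ (pre * (l.take b).prod) * φ (l.drop (b + 1)).prod := by
  induction l generalizing pre with
  | nil => simp [pairingSum]
  | cons y l ih =>
    rw [pairingSum, ih, List.length_cons, Finset.sum_range_succ', add_comm]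
    simp [mul_assoc]

theorem pairingSum_add_left (x x' pre : A) (l : List A) :
    pairingSum φ (x + x') pre l = pairingSum φ x pre l + pairingSum φ x' pre l := by
  induction l generalizing pre with
  | nil => simp [pairingSum]
  | cons y l ih => simp only [pairingSum, ih, add_mul, map_add]; ring

theorem pairingSum_smul_left (k : ℂ) (x pre : A) (l : List A) :
    pairingSum φ (k • x) pre l = k * pairingSum φ x pre l := by
  induction l generalizing pre with
  | nil => simp [pairingSum]
  | cons y l ih => simp only [pairingSum, ih, smul_mul_assoc, map_smul, smul_eq_mul]; ring

theorem pairingSum_add_pre (x u v : A) (l : List A) :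
    pairingSum φ x (u + v) l = pairingSum φ x u l + pairingSum φ x v l := by
  induction l generalizing u v with
  | nil => simp [pairingSum]
  | cons y l ih => simp only [pairingSum, add_mul, ih, map_add]; ring

theorem pairingSum_smul_pre (k : ℂ) (x u : A) (l : List A) :
    pairingSum φ x (k • u) l = k * pairingSum φ x u l := by
  induction l generalizing u with
  | nil => simp [pairingSum]
  | cons y l ih => simp only [pairingSum, smul_mul_assoc, ih, map_smul, smul_eq_mul]; ring

theorem pairingSum_add_mid (x pre y y' : A) (l l' : List A) :
    pairingSum φ x pre (l ++ (y + y') :: l') =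
      pairingSum φ x pre (l ++ y :: l') + pairingSum φ x pre (l ++ y' :: l') := by
  induction l generalizing pre with
  | nil => simp only [List.nil_append, pairingSum, mul_add, map_add, pairingSum_add_pre]; ring
  | cons z l ih =>
    simp only [List.cons_append, pairingSum, ih, List.prod_append, List.prod_cons, mul_add,
      add_mul, map_add]
    ring

theorem pairingSum_smul_mid (k : ℂ) (x pre y : A) (l l' : List A) :
    pairingSum φ x pre (l ++ (k • y) :: l') = k * pairingSum φ x pre (l ++ y :: l') := by
  induction l generalizing pre with
  | nil =>
    simp only [List.nil_append, pairingSum, mul_smul_comm, map_smul, pairingSum_smul_pre,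
      smul_eq_mul]
    ring
  | cons z l ih =>
    simp only [List.cons_append, pairingSum, ih, List.prod_append, List.prod_cons,
      smul_mul_assoc, mul_smul_comm, map_smul, smul_eq_mul]
    ring

/-- The recursion `φ (x * w) = ∑ φ (x * y) * φ u * φ v` over the factorizations `w = u * y * v`
extends by multilinearity from a set of letters to its linear span. -/
theorem apply_mul_prod_of_mem_span {S : Set A}
    (h : ∀ x ∈ S, ∀ l : List A, (∀ y ∈ l, y ∈ S) → φ (x * l.prod) = pairingSum φ x 1 l)
    {x : A} (hx : x ∈ Submodule.span ℂ S) {l : List A}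
    (hl : ∀ y ∈ l, y ∈ Submodule.span ℂ S) :
    φ (x * l.prod) = pairingSum φ x 1 l := by
  suffices H : ∀ l' l : List A, (∀ y ∈ l', y ∈ S) → (∀ y ∈ l, y ∈ Submodule.span ℂ S) →
      φ (x * (l' ++ l).prod) = pairingSum φ x 1 (l' ++ l) from H [] l (by simp) hl
  clear hl l
  intro l' l hl' hl
  induction l generalizing l' with
  | nil =>
    induction hx using Submodule.span_induction with
    | mem x hx => exact h x hx _ (by simpa using hl')
    | zero => simpa using (pairingSum_smul_left (φ := φ) 0 0 1 l').symm
    | add x y _ _ ihx ihy => rw [add_mul, map_add, ihx, ihy, pairingSum_add_left]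
    | smul k x _ ih => rw [smul_mul_assoc, map_smul, ih, pairingSum_smul_left, smul_eq_mul]
  | cons y l ih =>
    have hy := hl y (by simp)
    have hl2 : ∀ y ∈ l, y ∈ Submodule.span ℂ S := fun z hz => hl z (by simp [hz])
    clear hl
    induction hy using Submodule.span_induction with
    | mem y hy =>
      have := ih (l' ++ [y]) (by
        intro z hz
        rcases List.mem_append.1 hz with hz | hz
        · exact hl' z hz
        · rw [List.mem_singleton.1 hz]; exact hy) hl2
      simpa using this
    | zero =>
      have := pairingSum_smul_mid (φ := φ) 0 x 1 0 l' l
      rw [zero_smul, zero_mul] at this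
      rw [this]
      simp
    | add y y' _ _ ihy ihy' =>
      rw [pairingSum_add_mid, ← ihy, ← ihy']
      simp [mul_add, add_mul]
    | smul k y _ ihy =>
      rw [pairingSum_smul_mid, ← ihy]
      simp

theorem apply_mul_prod_semicircular {a : Fin 2 → A} (h1 : φ 1 = 1)
    (ha : ∀ z, IsSemicircular φ (a z)) (hf : IsFreeFamily φ a) {x : A} (hx : x ∈ Set.range a)
    {l : List A} (hl : ∀ y ∈ l, y ∈ Set.range a) :
    φ (x * l.prod) = pairingSum φ x 1 l := by
  obtain ⟨z, rfl⟩ := hx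
  obtain ⟨w, rfl⟩ : ∃ w : List (Fin 2), w.map a = l := by
    rw [← Set.mem_range, Set.range_list_map]
    exact hl
  have hcov : ∀ z z' : Fin 2, φ (a z * a z') = if z' = z then 1 else 0 := by
    intro z z'
    have := moment_cons ha hf z [z']
    simpa [h1] using this
  have h := moment_cons ha hf z w
  rw [List.map_cons, List.prod_cons] at h
  rw [h, pairingSum_eq_sum, List.length_map]
  refine Finset.sum_congr rfl fun b hb => ?_
  rw [Finset.mem_range] at hb
  have : (w.map a).getD b 0 = a (w.getD b 0) := by simp [hb]
  rw [this, hcov, one_mul, List.map_take, List.map_drop]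

/-- A letter of a word in `c` (`true`) and `star c` (`false`). -/
def circLetter (c : A) : Bool → A
  | true => c
  | false => star c

/-- The first letter of a word in a circular element and its adjoint is contracted with the letters
of the opposite kind. -/
theorem apply_word_cons (h1 : φ 1 = 1) {c : A} (hc : IsCircular φ c) (b : Bool) (w : List Bool) :
    φ (((b :: w).map (circLetter c)).prod) = ∑ i ∈ Finset.range w.length,
      (if w.getD i b = b then 0 else 1) * φ ((w.take i).map (circLetter c)).prod *
        φ ((w.drop (i + 1)).map (circLetter c)).prod := by
  obtain ⟨s, s', hs, hs', hf, hcs⟩ := hc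
  have ha : ∀ z, IsSemicircular φ (![s, s'] z) := by
    intro z; fin_cases z
    exacts [hs, hs']
  have key := fun (x : A) (hx : x ∈ Submodule.span ℂ (Set.range ![s, s'])) (l : List A) hl =>
    apply_mul_prod_of_mem_span (φ := φ) (S := Set.range ![s, s'])
      (fun x hx l hl => apply_mul_prod_semicircular h1 ha hf hx hl) hx (l := l) hl
  have hss : s ∈ Submodule.span ℂ (Set.range ![s, s']) := Submodule.subset_span ⟨0, rfl⟩
  have hss' : s' ∈ Submodule.span ℂ (Set.range ![s, s']) := Submodule.subset_span ⟨1, rfl⟩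
  have hc' : star c = ((Real.sqrt 2 : ℝ) : ℂ)⁻¹ • (s - Complex.I • s') := by
    rw [hcs, star_smul, star_add, star_smul, hs.1.star_eq, hs'.1.star_eq]
    simp [sub_eq_add_neg]
  have hl : ∀ b, circLetter c b ∈ Submodule.span ℂ (Set.range ![s, s']) := by
    rintro (_ | _)
    · rw [circLetter, hc']
      exact Submodule.smul_mem _ _ (sub_mem hss (Submodule.smul_mem _ _ hss'))
    · rw [circLetter, hcs]
      exact Submodule.smul_mem _ _ (add_mem hss (Submodule.smul_mem _ _ hss'))
  have hcov : ∀ z z' : Fin 2, φ (![s, s'] z * ![s, s'] z') = if z' = z then 1 else 0 := by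
    intro z z'
    have := moment_cons ha hf z [z']
    simpa [h1] using this
  have e00 : φ (s * s) = 1 := by simpa using hcov 0 0
  have e01 : φ (s * s') = 0 := by simpa using hcov 0 1
  have e10 : φ (s' * s) = 0 := by simpa using hcov 1 0
  have e11 : φ (s' * s') = 1 := by simpa using hcov 1 1
  have hsq : (((Real.sqrt 2 : ℝ) : ℂ)⁻¹) * (((Real.sqrt 2 : ℝ) : ℂ)⁻¹) = 1 / 2 := by
    rw [← mul_inv, ← Complex.ofReal_mul, Real.mul_self_sqrt (by norm_num)]
    norm_num
  have hcov2 : ∀ b b', φ (circLetter c b * circLetter c b') = if b' = b then 0 else 1 := by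
    have ht : ∀ b, circLetter c b = ((Real.sqrt 2 : ℝ) : ℂ)⁻¹ •
        (s + (if b then Complex.I else -Complex.I) • s') := by
      rintro (_ | _)
      · rw [circLetter, hc']; simp [sub_eq_add_neg]
      · rw [circLetter, hcs]; simp
    intro b b'
    rw [ht b, ht b', smul_mul_smul_comm, hsq, map_smul]
    simp only [add_mul, mul_add, map_add, smul_mul_assoc, mul_smul_comm, map_smul, e00, e01, e10,
      e11, smul_eq_mul]
    cases b <;> cases b' <;> norm_num [← mul_assoc]
  have hw : ∀ y ∈ w.map (circLetter c), y ∈ Submodule.span ℂ (Set.range ![s, s']) := by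
    intro y hy
    obtain ⟨b, -, rfl⟩ := List.mem_map.1 hy
    exact hl b
  rw [List.map_cons, List.prod_cons, key _ (hl b) _ hw,
    pairingSum_eq_sum, List.length_map]
  refine Finset.sum_congr rfl fun i hi => ?_
  rw [Finset.mem_range] at hi
  have : (w.map (circLetter c)).getD i 0 = circLetter c (w.getD i b) := by simp [hi]
  rw [this, hcov2, one_mul, List.map_take, List.map_drop]

end SchwingerDyson

/-! ### Combinatorics of the moments of a circular element -/

section CircularMoments

/-- A function on words with the properties of the `⋆`-moments of a circular element: the first
letter is contracted with the letters of the opposite kind, and the value of a word does not change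
under rotations. -/
structure IsCircularMoment (μ : List Bool → ℝ) : Prop where
  nil : μ [] = 1
  cons : ∀ b w, μ (b :: w) = ∑ i ∈ Finset.range w.length,
    (if w.getD i b = b then 0 else 1) * μ (w.take i) * μ (w.drop (i + 1))
  rotate : ∀ u v, μ (u ++ v) = μ (v ++ u)

/-- The sum of `f u v` over the factorizations of a word as `u`, a letter other than `b`, `v`. -/
def cutSum (b : Bool) (w : List Bool) (f : List Bool → List Bool → ℝ) : ℝ :=
  ∑ i ∈ Finset.range w.length, (if w.getD i b = b then 0 else 1) * f (w.take i) (w.drop (i + 1))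

theorem cutSum_append (b : Bool) (w w' : List Bool) (f : List Bool → List Bool → ℝ) :
    cutSum b (w ++ w') f =
      cutSum b w (fun u v => f u (v ++ w')) + cutSum b w' (fun u v => f (w ++ u) v) := by
  unfold cutSum
  rw [List.length_append, Finset.sum_range_add]
  congr 1
  · refine Finset.sum_congr rfl fun i hi => ?_
    rw [Finset.mem_range] at hi
    rw [List.getD_append _ _ _ _ hi, List.take_append_of_le_length hi.le,
      List.drop_append_of_le_length hi]
  · refine Finset.sum_congr rfl fun i _ => ?_
    rw [List.getD_append_right _ _ _ _ (by omega), List.take_length_add_append, add_assoc,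
      List.drop_length_add_append, Nat.add_sub_cancel_left]

theorem cutSum_replicate_self (b : Bool) (n : ℕ) (f : List Bool → List Bool → ℝ) :
    cutSum b (List.replicate n b) f = 0 := by
  refine Finset.sum_eq_zero fun i hi => ?_
  simp at hi
  simp

theorem cutSum_replicate_not (b : Bool) (n : ℕ) (f : List Bool → List Bool → ℝ) :
    cutSum b (List.replicate n (!b)) f =
      ∑ i ∈ Finset.range n, f (List.replicate i (!b)) (List.replicate (n - (i + 1)) (!b)) := by
  unfold cutSum
  rw [List.length_replicate]
  refine Finset.sum_congr rfl fun i hi => ?_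
  rw [Finset.mem_range] at hi
  simp [hi, hi.le]

theorem cutSum_sum {ι : Type*} (s : Finset ι) (b : Bool) (w : List Bool)
    (f : ι → List Bool → List Bool → ℝ) :
    cutSum b w (fun u v => ∑ k ∈ s, f k u v) = ∑ k ∈ s, cutSum b w (f k) := by
  unfold cutSum
  rw [Finset.sum_comm]
  exact Finset.sum_congr rfl fun i _ => Finset.mul_sum _ _ _

namespace IsCircularMoment

variable {μ : List Bool → ℝ} (h : IsCircularMoment μ)
include h

theorem cons_eq_cutSum (b : Bool) (w : List Bool) :
    μ (b :: w) = cutSum b w (fun u v => μ u * μ v) := by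
  rw [h.cons, cutSum]
  exact Finset.sum_congr rfl fun i _ => by ring

theorem nonneg (w : List Bool) : 0 ≤ μ w := by
  induction hn : w.length using Nat.strong_induction_on generalizing w with
  | _ n ih =>
    rcases w with _ | ⟨b, w⟩
    · rw [h.nil]; exact zero_le_one
    · rw [h.cons]
      refine Finset.sum_nonneg fun i _ => mul_nonneg (mul_nonneg (by split_ifs <;> norm_num) ?_) ?_
      · exact ih _ (by simp at hn ⊢; omega) _ rfl
      · exact ih _ (by simp at hn ⊢; omega) _ rfl

theorem eq_zero_of_count_ne (w : List Bool) (hw : w.count true ≠ w.count false) : μ w = 0 := by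
  induction hn : w.length using Nat.strong_induction_on generalizing w with
  | _ n ih =>
    rcases w with _ | ⟨b, w⟩
    · simp at hw
    · rw [h.cons]
      refine Finset.sum_eq_zero fun i hi => ?_
      rw [Finset.mem_range] at hi
      split_ifs with hb
      · simp
      · have hsplit : w = w.take i ++ (!b) :: w.drop (i + 1) := by
          have : w[i] = !b := by
            rw [List.getD_eq_getElem _ _ hi] at hb
            revert hb; cases w[i] <;> cases b <;> simp
          rw [← this, List.getElem_cons_drop, List.take_append_drop]
        have hne : (w.take i).count true ≠ (w.take i).count false ∨
            (w.drop (i + 1)).count true ≠ (w.drop (i + 1)).count false := by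
          by_contra hc
          push Not at hc
          apply hw
          rw [hsplit]
          simp only [List.count_cons, List.count_append, hc.1, hc.2]
          cases b <;> simp <;> omega
        rcases hne with hne | hne
        · rw [ih _ (by simp at hn ⊢; omega) _ hne rfl]; simp
        · rw [ih _ (by simp at hn ⊢; omega) _ hne rfl]; simp

theorem true_false (n k : ℕ) :
    μ (List.replicate n true ++ List.replicate k false) = if n = k then 1 else 0 := by
  split_ifs with hnk
  · subst hnk
    induction n with
    | zero => simpa using h.nil
    | succ n ih =>
      rw [List.replicate_succ, List.cons_append, h.cons_eq_cutSum, cutSum_append,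
        cutSum_replicate_self, zero_add]
      have := cutSum_replicate_not true (n + 1)
        fun u v => μ (List.replicate n true ++ u) * μ v
      rw [Bool.not_true] at this
      rw [this, Finset.sum_range_succ, ih, Finset.sum_eq_zero]
      · simp [h.nil]
      · intro i hi
        rw [Finset.mem_range] at hi
        rw [h.eq_zero_of_count_ne (List.replicate n true ++ _)]
        · simp
        · simp [List.count_replicate]; omega
  · apply h.eq_zero_of_count_ne
    simpa [List.count_replicate] using hnk

/-- A lower bound for the number of non-crossing pairings of a word with four runs. -/
theorem le_four_runs (n k r : ℕ) :
    (min n k + 1 : ℕ) ≤ μ (List.replicate n true ++ List.replicate (n + r) false ++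
      List.replicate (r + k) true ++ List.replicate k false) := by
  induction n generalizing k r with
  | zero =>
    rw [List.replicate_zero, List.nil_append, List.append_assoc, h.rotate, List.append_assoc,
      List.replicate_append_replicate, h.true_false]
    simp [add_comm]
  | succ n ih =>
    rcases k with _ | k
    · rw [List.replicate_zero, List.append_nil, h.rotate, ← List.append_assoc,
        List.replicate_append_replicate, h.true_false]
      simp [add_comm]
    · rw [List.replicate_succ (n := n), List.cons_append, List.cons_append, List.cons_append,
        h.cons_eq_cutSum, cutSum_append, cutSum_append, cutSum_append, cutSum_replicate_self,
        cutSum_replicate_self, zero_add, add_zero]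
      have e := fun n => cutSum_replicate_not true n
      rw [Bool.not_true] at e
      rw [e, e]
      -- the first letter is paired inside the second run, or with the last letter of the word
      have h1 := Finset.single_le_sum (s := Finset.range (n + 1 + r)) (f := fun i =>
        μ (List.replicate n true ++ List.replicate i false) *
          μ (List.replicate (n + 1 + r - (i + 1)) false ++ List.replicate (r + (k + 1)) true ++
            List.replicate (k + 1) false))
        (fun i _ => mul_nonneg (h.nonneg _) (h.nonneg _))
        (Finset.mem_range.2 (show n < n + 1 + r by omega))
      have h2 := Finset.single_le_sum (s := Finset.range (k + 1)) (f := fun i =>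
        μ (List.replicate n true ++ List.replicate (n + 1 + r) false ++
          List.replicate (r + (k + 1)) true ++ List.replicate i false) *
          μ (List.replicate (k + 1 - (i + 1)) false))
        (fun i _ => mul_nonneg (h.nonneg _) (h.nonneg _))
        (Finset.mem_range.2 (show k < k + 1 by omega))
      have h3 := ih k (r + 1)
      rw [h.true_false, if_pos rfl, one_mul, List.append_assoc, h.rotate, List.append_assoc,
        List.replicate_append_replicate, h.true_false, if_pos (by omega)] at h1
      rw [Nat.sub_self, List.replicate_zero, h.nil, mul_one] at h2
      rw [show n + (r + 1) = n + 1 + r by ring, show r + 1 + k = r + (k + 1) by ring] at h3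
      have h4 : ((min (n + 1) (k + 1) + 1 : ℕ) : ℝ) = 1 + (min n k + 1 : ℕ) := by
        rw [Nat.succ_min_succ]; push_cast; ring
      rw [h4]
      exact add_le_add h1 (h3.trans h2)

end IsCircularMoment

/-- The sum over all `k₁, …, kₘ < K` of the moments of the words
`w c^{n₁} c⋆^{k₁} ⋯ c^{nₘ} c⋆^{kₘ}`. -/
def runSum (μ : List Bool → ℝ) (K : ℕ) : List Bool → List ℕ → ℝ
  | w, [] => μ w
  | w, n :: ns => ∑ k ∈ Finset.range K,
      runSum μ K (w ++ List.replicate n true ++ List.replicate k false) ns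

/-- The sum of the contributions to `runSum μ K (true :: w) ns` in which the additional first letter
is paired with a letter outside of `w`. -/
def runCutSum (μ : List Bool → ℝ) (K : ℕ) : List Bool → List ℕ → ℝ
  | _, [] => 0
  | w, n :: ns => ∑ k ∈ Finset.range K,
      ((∑ i ∈ Finset.range k, μ (w ++ List.replicate n true ++ List.replicate i false) *
          runSum μ K (List.replicate (k - (i + 1)) false) ns) +
        runCutSum μ K (w ++ List.replicate n true ++ List.replicate k false) ns)

theorem sum_triangle_le {g : ℕ → ℕ → ℝ} (hg : ∀ i q, 0 ≤ g i q) (K : ℕ) :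
    ∑ k ∈ Finset.range K, ∑ i ∈ Finset.range k, g i (k - (i + 1)) ≤
      ∑ i ∈ Finset.range K, ∑ q ∈ Finset.range K, g i q := by
  rcases K with _ | K
  · simp
  · rw [Finset.sum_range_succ', Finset.range_zero, Finset.sum_empty, add_zero]
    simp only [Nat.add_sub_add_right]
    rw [Finset.sum_range_diag_flip K g]
    refine (Finset.sum_le_sum fun i _ => Finset.sum_le_sum_of_subset_of_nonneg
      (Finset.range_subset_range.2 (show K - i ≤ K + 1 by omega)) fun _ _ _ => hg _ _).trans ?_
    exact Finset.sum_le_sum_of_subset_of_nonneg (Finset.range_subset_range.2 (Nat.le_succ K))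
      fun _ _ _ => Finset.sum_nonneg fun _ _ => hg _ _

/-- The sum of the `runSum`s over all initial runs of less than `K` letters `false`. -/
def cyclicRunSum (μ : List Bool → ℝ) (K : ℕ) (ns : List ℕ) : ℝ :=
  ∑ q ∈ Finset.range K, runSum μ K (List.replicate q false) ns

theorem runSum_zero (μ : List Bool → ℝ) (K : ℕ) (ns : List ℕ) :
    runSum μ K [] (0 :: ns) = cyclicRunSum μ K ns := by
  simp [runSum, cyclicRunSum]

namespace IsCircularMoment

variable {μ : List Bool → ℝ} (h : IsCircularMoment μ)
include h

theorem runSum_nonneg (K : ℕ) (w : List Bool) (ns : List ℕ) : 0 ≤ runSum μ K w ns := by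
  induction ns generalizing w with
  | nil => exact h.nonneg w
  | cons n ns ih => exact Finset.sum_nonneg fun k _ => ih _

theorem runSum_mono {K K' : ℕ} (hK : K ≤ K') (w : List Bool) (ns : List ℕ) :
    runSum μ K w ns ≤ runSum μ K' w ns := by
  induction ns generalizing w with
  | nil => exact le_rfl
  | cons n ns ih =>
    exact (Finset.sum_le_sum fun k _ => ih _).trans (Finset.sum_le_sum_of_subset_of_nonneg
      (Finset.range_subset_range.2 hK) fun k _ _ => h.runSum_nonneg _ _ _)

theorem runSum_true_cons (K : ℕ) (w : List Bool) (ns : List ℕ) :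
    runSum μ K (true :: w) ns =
      cutSum true w (fun u v => μ u * runSum μ K v ns) + runCutSum μ K w ns := by
  induction ns generalizing w with
  | nil => simp only [runSum, runCutSum, add_zero, h.cons_eq_cutSum]
  | cons n ns ih =>
    have e := fun n => cutSum_replicate_not true n
    rw [Bool.not_true] at e
    simp only [runSum, List.cons_append, ih, cutSum_append, cutSum_replicate_self, add_zero, e,
      runCutSum, Finset.mul_sum, cutSum_sum, Finset.sum_add_distrib]
    ring

theorem runCutSum_le (K : ℕ) (w : List Bool) (ns : List ℕ) :
    runCutSum μ K w ns ≤ ∑ i ∈ Finset.range ns.length,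
      runSum μ K w (ns.take (i + 1)) * cyclicRunSum μ K (ns.drop (i + 1)) := by
  induction ns generalizing w with
  | nil => simp [runCutSum]
  | cons n ns ih =>
    rw [runCutSum, Finset.sum_add_distrib, List.length_cons, Finset.sum_range_succ', add_comm]
    refine add_le_add ?_ ?_
    · refine (Finset.sum_le_sum fun k _ => ih _).trans (le_of_eq ?_)
      rw [Finset.sum_comm]
      refine Finset.sum_congr rfl fun i _ => ?_
      rw [← Finset.sum_mul]
      rfl
    · simp only [zero_add, List.take_succ_cons, List.take_zero, List.drop_succ_cons, List.drop_zero,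
        runSum, cyclicRunSum]
      rw [Finset.sum_mul_sum]
      exact sum_triangle_le (g := fun i q => μ (w ++ List.replicate n true ++
        List.replicate i false) * runSum μ K (List.replicate q false) ns)
        (fun _ _ => mul_nonneg (h.nonneg _) (h.runSum_nonneg _ _ _)) K

theorem cyclicRunSum_nil_le (K : ℕ) : cyclicRunSum μ K [] ≤ 1 := by
  rcases K with _ | K
  · simp [cyclicRunSum]
  · rw [cyclicRunSum, Finset.sum_range_succ', Finset.sum_eq_zero]
    · simp [runSum, h.nil]
    · intro q _
      apply h.eq_zero_of_count_ne
      simp [List.count_replicate]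

/-- By rotation, an initial run of letters `false` extends the last run of the word, so that there
are at most `S + 1` ways to obtain each word. -/
theorem sum_false_append_le {S K : ℕ} (hK : S < K) (w : List Bool) (n : ℕ) (ns : List ℕ)
    (hS : w.count true + n + ns.sum ≤ S) :
    ∑ q ∈ Finset.range K, ∑ k ∈ Finset.range K, runSum μ K
        (List.replicate q false ++ (w ++ List.replicate n true ++ List.replicate k false)) ns ≤
      (S + 1) * ∑ k ∈ Finset.range K,
        runSum μ K (w ++ List.replicate n true ++ List.replicate k false) ns := by
  induction ns generalizing w n with
  | nil =>
    simp only [runSum]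
    set f : ℕ → ℝ := fun j => μ (w ++ List.replicate n true ++ List.replicate j false) with hf
    have hf0 : ∀ j, 0 ≤ f j := fun j => h.nonneg _
    have hfS : ∀ j, S < j → f j = 0 := fun j hj => by
      apply h.eq_zero_of_count_ne
      simp [List.count_replicate] at hS ⊢
      omega
    have hrot : ∀ q k, μ (List.replicate q false ++ (w ++ List.replicate n true ++
        List.replicate k false)) = f (k + q) := fun q k => by
      rw [h.rotate, List.append_assoc, List.replicate_append_replicate]
    simp only [hrot]
    have hle : ∀ q, ∑ k ∈ Finset.range K, f (k + q) ≤ ∑ j ∈ Finset.range K, f j := by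
      intro q
      have h1 : ∑ k ∈ Finset.range K, f (k + q) = ∑ j ∈ Finset.Ico q (K + q), f j := by
        rw [Finset.range_eq_Ico, Finset.sum_Ico_add' f 0 K q, zero_add]
      rw [h1, ← Finset.sum_filter_of_ne (p := fun j => j < K)]
      · exact Finset.sum_le_sum_of_subset_of_nonneg (fun j hj => by simp at hj ⊢; exact hj.2)
          fun _ _ _ => hf0 _
      · intro j _ hj
        by_contra hc
        exact hj (hfS j (by omega))
    have hq : ∀ q, S < q → ∑ k ∈ Finset.range K, f (k + q) = 0 := fun q hq =>
      Finset.sum_eq_zero fun k _ => hfS _ (by omega)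
    calc ∑ q ∈ Finset.range K, ∑ k ∈ Finset.range K, f (k + q)
        = ∑ q ∈ Finset.range (S + 1), ∑ k ∈ Finset.range K, f (k + q) := by
          refine (Finset.sum_subset (Finset.range_subset_range.2 hK) fun q _ h' => hq q ?_).symm
          simpa using h'
      _ ≤ ∑ q ∈ Finset.range (S + 1), ∑ j ∈ Finset.range K, f j :=
          Finset.sum_le_sum fun q _ => hle q
      _ = (S + 1) * ∑ j ∈ Finset.range K, f j := by simp
  | cons n' ns ih =>
    simp only [runSum]
    rw [Finset.sum_comm, Finset.mul_sum]
    refine Finset.sum_le_sum fun k _ => ?_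
    have := ih (w ++ List.replicate n true ++ List.replicate k false) n' (by
      simp [List.count_replicate] at hS ⊢; omega)
    simpa only [List.append_assoc] using this

theorem cyclicRunSum_cons_le {S K : ℕ} (hK : S < K) (n : ℕ) (ns : List ℕ)
    (hS : n + ns.sum ≤ S) :
    cyclicRunSum μ K (n :: ns) ≤ (S + 1) * runSum μ K [] (n :: ns) := by
  have := h.sum_false_append_le hK [] n ns (by simpa using hS)
  simpa [cyclicRunSum, runSum] using this

/-- The first letter is contracted with a letter of one of the runs of `c⋆`, which splits the word in
two; the summand after the sum is the contraction with the last of these runs. -/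
theorem runSum_succ_le (K n : ℕ) (ns : List ℕ) :
    runSum μ K [] ((n + 1) :: ns) ≤ ∑ i ∈ Finset.range ns.length,
      runSum μ K [] (n :: ns.take i) * cyclicRunSum μ K (ns.drop i) + runSum μ K [] (n :: ns) := by
  have h1 : runSum μ K [] ((n + 1) :: ns) = runSum μ K [true] (n :: ns) := by
    simp only [runSum]
    rfl
  rw [h1, h.runSum_true_cons]
  refine le_trans (le_of_eq (by simp [cutSum])) ((h.runCutSum_le K [] (n :: ns)).trans ?_)
  rw [List.length_cons, Finset.sum_range_succ]
  simp only [List.take_succ_cons, List.drop_succ_cons, List.take_length, List.drop_length]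
  gcongr
  exact mul_le_of_le_one_right (h.runSum_nonneg _ _ _) (h.cyclicRunSum_nil_le K)

end IsCircularMoment

/-- The number of non-crossing pairings of the words `c^{n₁} c⋆^{k₁} ⋯ c^{nₘ} c⋆^{kₘ}` with given
`n₁, …, nₘ` grows at most like the power `2 (m - 1)` of `n₁ + ⋯ + nₘ`. -/
theorem exists_runSum_le (m : ℕ) : ∃ C : ℝ, 1 ≤ C ∧ ∀ μ, IsCircularMoment μ →
    ∀ (ns : List ℕ) (n S K : ℕ), ns.length ≤ m → n + ns.sum ≤ S → S < K →
      runSum μ K [] (n :: ns) ≤ C * ((S : ℝ) + 1) ^ (2 * ns.length) := by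
  induction m with
  | zero =>
    refine ⟨1, le_rfl, fun μ h ns n S K hm hS hK => ?_⟩
    obtain rfl : ns = [] := List.length_eq_zero_iff.1 (Nat.le_zero.1 hm)
    clear hS
    induction n with
    | zero => simpa [runSum_zero] using h.cyclicRunSum_nil_le K
    | succ n ih => exact (h.runSum_succ_le K n []).trans (by simpa using ih)
  | succ m ih =>
    obtain ⟨C, hC, ih⟩ := ih
    refine ⟨C + (m + 1) * C ^ 2, by nlinarith [sq_nonneg C], fun μ h ns n S K hm hS hK => ?_⟩
    have hS1 : (1 : ℝ) ≤ (S : ℝ) + 1 := by simp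
    rcases ns with _ | ⟨n', ns⟩
    · refine (ih μ h [] n S K (Nat.zero_le _) hS hK).trans ?_
      simp; positivity
    rw [List.length_cons] at hm ⊢
    -- the inequality is proved for smaller first runs, with a linear dependence on the first run
    have key : ∀ j ≤ n, runSum μ K [] (j :: n' :: ns) ≤
        (C + j * ((m + 1) * C ^ 2)) * ((S : ℝ) + 1) ^ (2 * ns.length + 1) := by
      intro j hj
      induction j with
      | zero =>
        rw [runSum_zero]
        refine (h.cyclicRunSum_cons_le hK n' ns (by simp at hS; omega)).trans ?_
        refine (mul_le_mul_of_nonneg_left (ih μ h ns n' S K (by omega) (by simp at hS; omega) hK)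
          (by positivity)).trans (le_of_eq ?_)
        push_cast
        ring
      | succ j ihj =>
        refine (h.runSum_succ_le K j _).trans ((add_le_add (Finset.sum_le_sum (g := fun _ =>
          C ^ 2 * ((S : ℝ) + 1) ^ (2 * ns.length + 1)) fun i hi => ?_)
          (ihj (by omega))).trans ?_)
        · rw [Finset.mem_range] at hi
          have hdrop : (n' :: ns).drop i = (n' :: ns)[i] :: (n' :: ns).drop (i + 1) :=
            List.drop_eq_getElem_cons hi
          have hsum : ((n' :: ns).take i).sum + ((n' :: ns)[i] + ((n' :: ns).drop (i + 1)).sum) =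
              (n' :: ns).sum := by
            rw [← List.sum_cons, ← hdrop, ← List.sum_append, List.take_append_drop]
          rw [List.length_cons] at hi
          have h1 := ih μ h ((n' :: ns).take i) j S K (by simp; omega) (by omega) hK
          have h2 := h.cyclicRunSum_cons_le hK ((n' :: ns)[i]) ((n' :: ns).drop (i + 1)) (by omega)
          have h3 := ih μ h ((n' :: ns).drop (i + 1)) ((n' :: ns)[i]) S K (by simp; omega)
            (by omega) hK
          rw [hdrop]
          refine (mul_le_mul h1 (h2.trans (mul_le_mul_of_nonneg_left h3 (by positivity)))
            (Finset.sum_nonneg fun _ _ => h.runSum_nonneg _ _ _) (by positivity)).trans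
            (le_of_eq ?_)
          rw [List.length_take, List.length_drop, List.length_cons, min_eq_left hi.le,
            show 2 * ns.length + 1 = 2 * i + 2 * (ns.length + 1 - (i + 1)) + 1 by omega]
          ring
        · rw [Finset.sum_const, Finset.card_range, nsmul_eq_mul, List.length_cons]
          have hl : ((ns.length + 1 : ℕ) : ℝ) ≤ m + 1 := by exact_mod_cast hm
          have := mul_le_mul_of_nonneg_right hl
            (show 0 ≤ C ^ 2 * ((S : ℝ) + 1) ^ (2 * ns.length + 1) by positivity)
          push_cast at this ⊢
          linarith
    refine (key n le_rfl).trans ?_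
    have hn : (n : ℝ) ≤ S := by exact_mod_cast (le_trans (Nat.le_add_right _ _) hS)
    rw [show (C + (m + 1) * C ^ 2) * ((S : ℝ) + 1) ^ (2 * (ns.length + 1)) =
      (C + (m + 1) * C ^ 2) * (S + 1) * ((S : ℝ) + 1) ^ (2 * ns.length + 1) by ring]
    refine mul_le_mul_of_nonneg_right ?_
      (show 0 ≤ ((S : ℝ) + 1) ^ (2 * ns.length + 1) by positivity)
    have : (n : ℝ) * ((m + 1) * C ^ 2) ≤ S * ((m + 1) * C ^ 2) :=
      mul_le_mul_of_nonneg_right hn (by positivity)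
    have h5 : 0 ≤ C * S := by positivity
    have h6 : 0 ≤ (m + 1) * C ^ 2 := by positivity
    linarith

end CircularMoments

/-! ### Sums of moments with weights -/

section TraceEstimates

/-- The sum of `∏ uₙᵢ vₖᵢ` times the moment of `w c^{n₁} c⋆^{k₁} ⋯ c^{nⱼ} c⋆^{kⱼ}` over all
exponents less than `K`. -/
def weightedRunSum (μ : List Bool → ℝ) (K : ℕ) (u v : ℕ → ℝ) : ℕ → List Bool → ℝ
  | 0, w => μ w
  | j + 1, w => ∑ n ∈ Finset.range K, ∑ k ∈ Finset.range K, u n * v k *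
      weightedRunSum μ K u v j (w ++ List.replicate n true ++ List.replicate k false)

/-- The arithmetic-geometric mean inequality, applied to the products of all the weights. The
factors `x` and `y` carry the weights already collected in the induction. -/
theorem weightedRunSum_amgm {μ : List Bool → ℝ} (h : IsCircularMoment μ) (K : ℕ) (u v : ℕ → ℝ)
    (j : ℕ) (w : List Bool) (x y : ℝ) :
    x * y * weightedRunSum μ K u v j w ≤
      (x ^ 2 * weightedRunSum μ K (fun n => u n ^ 2) (fun _ => 1) j w +
        y ^ 2 * weightedRunSum μ K (fun _ => 1) (fun n => v n ^ 2) j w) / 2 := by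
  induction j generalizing w x y with
  | zero =>
    simp only [weightedRunSum]
    nlinarith [mul_nonneg (sq_nonneg (x - y)) (h.nonneg w)]
  | succ j ih =>
    simp only [weightedRunSum, Finset.mul_sum, ← Finset.sum_add_distrib, Finset.sum_div]
    refine Finset.sum_le_sum fun n _ => Finset.sum_le_sum fun k _ => ?_
    have := ih (w ++ List.replicate n true ++ List.replicate k false) (x * u n) (y * v k)
    linarith

/-- A bound for the moments summed over the exponents of `c⋆` gives a bound for the sum weighted by
the exponents of `c`. The family `w` of initial words is what makes the induction on `j` possible. -/
theorem sum_weightedRunSum_le {μ : List Bool → ℝ} {K : ℕ} {u d : ℕ → ℝ} (hu : ∀ n, 0 ≤ u n)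
    (j : ℕ) {ι : Type} (s : Finset ι) (w : ι → List Bool) (B : ℝ)
    (hB : ∀ ns : List ℕ, ns.length = j →
      ∑ i ∈ s, runSum μ K (w i) ns ≤ B * (ns.map d).prod) :
    ∑ i ∈ s, weightedRunSum μ K u (fun _ => 1) j (w i) ≤
      B * (∑ n ∈ Finset.range K, u n * d n) ^ j := by
  induction j generalizing ι s w B with
  | zero => simpa [weightedRunSum, runSum] using hB [] rfl
  | succ j ih =>
    have h1 : ∀ n, ∑ x ∈ s ×ˢ Finset.range K, weightedRunSum μ K u (fun _ => 1) j
        (w x.1 ++ List.replicate n true ++ List.replicate x.2 false) ≤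
          (B * d n) * (∑ n ∈ Finset.range K, u n * d n) ^ j := by
      intro n
      refine ih (s ×ˢ Finset.range K)
        (fun x => w x.1 ++ List.replicate n true ++ List.replicate x.2 false) (B * d n) ?_
      intro ns hns
      rw [Finset.sum_product]
      have := hB (n :: ns) (by simp [hns])
      simpa [runSum, mul_assoc] using this
    calc ∑ i ∈ s, weightedRunSum μ K u (fun _ => 1) (j + 1) (w i)
        = ∑ n ∈ Finset.range K, u n * ∑ x ∈ s ×ˢ Finset.range K,
            weightedRunSum μ K u (fun _ => 1) j
              (w x.1 ++ List.replicate n true ++ List.replicate x.2 false) := by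
          simp only [weightedRunSum, mul_one]
          rw [Finset.sum_comm]
          refine Finset.sum_congr rfl fun n _ => ?_
          rw [Finset.sum_product, Finset.mul_sum]
          exact Finset.sum_congr rfl fun i _ => (Finset.mul_sum _ _ _).symm
      _ ≤ ∑ n ∈ Finset.range K, u n * ((B * d n) * (∑ n ∈ Finset.range K, u n * d n) ^ j) :=
          Finset.sum_le_sum fun n _ => mul_le_mul_of_nonneg_left (h1 n) (hu n)
      _ = B * (∑ n ∈ Finset.range K, u n * d n) ^ (j + 1) := by
          rw [pow_succ', ← mul_assoc B, Finset.mul_sum, Finset.sum_mul]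
          exact Finset.sum_congr rfl fun n _ => by ring

theorem pow_le_exp_div_pow {t : ℝ} (ht : 0 < t) (ht1 : t < 1) (m S : ℕ) :
    ((S : ℝ) + 1) ^ m ≤ m.factorial * Real.exp 1 * (1 / t) ^ m * Real.exp (2 * t * S) := by
  have h1 := Real.pow_div_factorial_le_exp (t * (S + 1)) (by positivity) m
  rw [div_le_iff₀ (by positivity), mul_pow] at h1
  have h2 : Real.exp (t * (S + 1)) ≤ Real.exp 1 * Real.exp (2 * t * S) := by
    rw [← Real.exp_add]
    apply Real.exp_le_exp.2
    nlinarith [mul_nonneg ht.le (Nat.cast_nonneg (α := ℝ) S)]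
  have h3 : ((S : ℝ) + 1) ^ m = (1 / t) ^ m * (t ^ m * ((S : ℝ) + 1) ^ m) := by
    rw [← mul_assoc, ← mul_pow, one_div_mul_cancel ht.ne', one_pow, one_mul]
  rw [h3]
  calc (1 / t) ^ m * (t ^ m * ((S : ℝ) + 1) ^ m)
      ≤ (1 / t) ^ m * ((Real.exp 1 * Real.exp (2 * t * S)) * m.factorial) := by
        refine mul_le_mul_of_nonneg_left (h1.trans ?_) (by positivity)
        exact mul_le_mul_of_nonneg_right h2 (by positivity)
    _ = _ := by ring

/-- The bound for the weighted sums of moments which gives the `L²`-`L^p` estimate for the dilation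
semigroup. -/
theorem exists_weightedRunSum_le (m : ℕ) : ∃ C : ℝ, 0 < C ∧ ∀ μ, IsCircularMoment μ →
    ∀ t : ℝ, 0 < t → t < 1 → ∀ (K : ℕ) (a : ℕ → ℝ),
      weightedRunSum μ K (fun n => (Real.exp (-(n * t)) * a n) ^ 2) (fun _ => 1) (m + 1) [] ≤
        C * (1 / t) ^ (2 * m) * (∑ n ∈ Finset.range K, a n ^ 2) ^ (m + 1) := by
  obtain ⟨C, hC, hb⟩ := exists_runSum_le m
  refine ⟨C * ((2 * m).factorial * Real.exp 1), by positivity, fun μ h t ht ht1 K a => ?_⟩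
  have := sum_weightedRunSum_le (μ := μ) (K := K)
    (u := fun n => (Real.exp (-(n * t)) * a n) ^ 2) (d := fun n => Real.exp (2 * t * n))
    (fun n => sq_nonneg _) (m + 1) ({()} : Finset Unit) (fun _ => [])
    (C * ((2 * m).factorial * Real.exp 1) * (1 / t) ^ (2 * m)) ?_
  · rw [Finset.sum_singleton] at this
    refine this.trans (le_of_eq ?_)
    congr 2
    refine Finset.sum_congr rfl fun n _ => ?_
    rw [mul_pow, mul_right_comm, ← Real.exp_nat_mul, ← Real.exp_add]
    push_cast
    rw [show 2 * -((n : ℝ) * t) + 2 * t * n = 0 by ring, Real.exp_zero, one_mul]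
  · intro ns hns
    rw [Finset.sum_singleton]
    rcases ns with _ | ⟨n, ns⟩
    · simp at hns
    have hns : ns.length = m := by simpa using hns
    have hprod : ∀ l : List ℕ, (l.map fun n : ℕ => Real.exp (2 * t * n)).prod =
        Real.exp (2 * t * (l.sum : ℕ)) := by
      intro l
      induction l with
      | nil => simp
      | cons n l ih =>
        rw [List.map_cons, List.prod_cons, ih, List.sum_cons, ← Real.exp_add]
        push_cast
        ring_nf
    rw [hprod]
    set S := (n :: ns).sum with hS
    have h1 := hb μ h ns n S (K + S + 1) hns.le (by rw [hS, List.sum_cons]) (by omega)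
    rw [hns] at h1
    refine (h.runSum_mono (show K ≤ K + S + 1 by omega) _ _).trans (h1.trans ?_)
    have h2 := pow_le_exp_div_pow ht ht1 (2 * m) S
    calc C * ((S : ℝ) + 1) ^ (2 * m) ≤ C * ((2 * m).factorial * Real.exp 1 * (1 / t) ^ (2 * m) *
          Real.exp (2 * t * S)) := by gcongr
      _ = _ := by ring

/-- The moment of order two of `y * star y`, `y = 1 + c + ⋯ + c ^ (3 * L - 1)`, is at least
`L ^ 4`. -/
theorem pow_four_le_weightedRunSum {μ : List Bool → ℝ} (h : IsCircularMoment μ) (L : ℕ) :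
    (L : ℝ) ^ 4 ≤ weightedRunSum μ (3 * L) (fun _ => 1) (fun _ => 1) 2 [] := by
  have hL : Finset.Ico L (2 * L) ⊆ Finset.range (3 * L) := fun n hn => by simp at hn ⊢; omega
  have hsub : ∀ n ≤ 2 * L, ∀ f : ℕ → ℝ, (∀ k, 0 ≤ f k) →
      ∑ r ∈ Finset.range L, f (n + r) ≤ ∑ k ∈ Finset.range (3 * L), f k := by
    intro n hn f hf
    have := Finset.sum_Ico_eq_sum_range f n (n + L)
    rw [Nat.add_sub_cancel_left] at this
    rw [← this]
    exact Finset.sum_le_sum_of_subset_of_nonneg (fun k hk => by simp at hk ⊢; omega)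
      fun k _ _ => hf k
  set f : ℕ → ℕ → ℕ → ℕ → ℝ := fun n k n' k' => μ (List.replicate n true ++
    List.replicate k false ++ List.replicate n' true ++ List.replicate k' false) with hf
  have hf0 : ∀ n k n' k', 0 ≤ f n k n' k' := fun _ _ _ _ => h.nonneg _
  have hexp : weightedRunSum μ (3 * L) (fun _ => 1) (fun _ => 1) 2 [] =
      ∑ n ∈ Finset.range (3 * L), ∑ k ∈ Finset.range (3 * L), ∑ n' ∈ Finset.range (3 * L),
        ∑ k' ∈ Finset.range (3 * L), f n k n' k' := by
    simp only [weightedRunSum, one_mul, mul_one, List.nil_append, hf]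
  -- only the exponents `n, n + r, r + k, k` with `L ≤ n, k < 2 L` and `r < L` are kept
  have hin : ∀ n ∈ Finset.Ico L (2 * L), ∀ r ∈ Finset.range L,
      (L : ℝ) * L ≤ ∑ n' ∈ Finset.range (3 * L), ∑ k' ∈ Finset.range (3 * L),
        f n (n + r) n' k' := by
    intro n hn r hr
    rw [Finset.mem_Ico] at hn
    rw [Finset.mem_range] at hr
    rw [Finset.sum_comm]
    calc (L : ℝ) * L = ∑ k ∈ Finset.Ico L (2 * L), (L : ℝ) := by
          rw [Finset.sum_const, Nat.card_Ico, nsmul_eq_mul, two_mul, Nat.add_sub_cancel_left]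
      _ ≤ ∑ k ∈ Finset.Ico L (2 * L), ∑ n' ∈ Finset.range (3 * L), f n (n + r) n' k := by
          refine Finset.sum_le_sum fun k hk => ?_
          rw [Finset.mem_Ico] at hk
          refine le_trans ?_ (Finset.single_le_sum (f := fun n' => f n (n + r) n' k)
            (fun n' _ => hf0 _ _ _ _) (Finset.mem_range.2 (show r + k < 3 * L by omega)))
          refine le_trans ?_ (h.le_four_runs n k r)
          exact_mod_cast (show L ≤ min n k + 1 by omega)
      _ ≤ _ := Finset.sum_le_sum_of_subset_of_nonneg hL fun k _ _ =>
          Finset.sum_nonneg fun _ _ => hf0 _ _ _ _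
  rw [hexp]
  calc (L : ℝ) ^ 4 = ∑ n ∈ Finset.Ico L (2 * L), ∑ r ∈ Finset.range L, (L : ℝ) * L := by
        rw [Finset.sum_const, Finset.sum_const, Nat.card_Ico, Finset.card_range, nsmul_eq_mul,
          nsmul_eq_mul, two_mul, Nat.add_sub_cancel_left]
        ring
    _ ≤ ∑ n ∈ Finset.Ico L (2 * L), ∑ k ∈ Finset.range (3 * L), ∑ n' ∈ Finset.range (3 * L),
        ∑ k' ∈ Finset.range (3 * L), f n k n' k' := by
        refine Finset.sum_le_sum fun n hn => ?_
        refine (Finset.sum_le_sum fun r hr => hin n hn r hr).trans (hsub n ?_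
          (fun k => ∑ n' ∈ Finset.range (3 * L), ∑ k' ∈ Finset.range (3 * L), f n k n' k')
          fun k => ?_)
        · rw [Finset.mem_Ico] at hn; omega
        · exact Finset.sum_nonneg fun _ _ => Finset.sum_nonneg fun _ _ => hf0 _ _ _ _
    _ ≤ _ := Finset.sum_le_sum_of_subset_of_nonneg hL fun n _ _ => Finset.sum_nonneg fun _ _ =>
          Finset.sum_nonneg fun _ _ => Finset.sum_nonneg fun _ _ => hf0 _ _ _ _

end TraceEstimates

/-! ### Traces of powers of polynomials in a circular element -/

section HolPoly

variable {A : Type*} [CStarAlgebra A]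

/-- The polynomial of degree less than `K` in `c` with the coefficients `a`. -/
noncomputable def holPoly (c : A) (K : ℕ) (a : ℕ → ℂ) : A :=
  ∑ n ∈ Finset.range K, a n • c ^ n

theorem star_holPoly (c : A) (K : ℕ) (a : ℕ → ℂ) :
    star (holPoly c K a) = ∑ n ∈ Finset.range K, star (a n) • star c ^ n := by
  simp [holPoly, star_sum]

theorem word_append_runs (c : A) (w : List Bool) (n k : ℕ) :
    ((w ++ List.replicate n true ++ List.replicate k false).map (circLetter c)).prod =
      (w.map (circLetter c)).prod * (c ^ n * star c ^ k) := by
  simp [circLetter]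

theorem holPoly_sub (c : A) {N K : ℕ} (hNK : N ≤ K) (a : ℕ → ℂ) :
    holPoly c K a - holPoly c N a = holPoly c K fun n => if n < N then 0 else a n := by
  rw [sub_eq_iff_eq_add, holPoly, holPoly, holPoly]
  have : ∑ n ∈ Finset.range N, a n • c ^ n =
      ∑ n ∈ Finset.range K, if n < N then a n • c ^ n else 0 := by
    rw [← Finset.sum_filter]
    congr 1
    ext n
    simp
    omega
  rw [this, ← Finset.sum_add_distrib]
  refine Finset.sum_congr rfl fun n _ => ?_
  split_ifs <;> simp

end HolPoly

section PolynomialTraces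

variable {A : Type*} [CStarAlgebra A] [PartialOrder A] {φ : A →ₚ[ℂ] ℂ} {c : A}

/-- The real part of the moment of a word in `c` and `star c`. -/
noncomputable def circMoment (φ : A →ₚ[ℂ] ℂ) (c : A) (w : List Bool) : ℝ :=
  (φ ((w.map (circLetter c)).prod)).re

theorem apply_word (h1 : φ 1 = 1) (hc : IsCircular φ c) (w : List Bool) :
    φ ((w.map (circLetter c)).prod) = circMoment φ c w := by
  suffices him : (φ ((w.map (circLetter c)).prod)).im = 0 from
    Complex.ext (by simp [circMoment]) (by simpa using him)
  induction hn : w.length using Nat.strong_induction_on generalizing w with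
  | _ n ih =>
    rcases w with _ | ⟨b, w⟩
    · simp [h1]
    · rw [apply_word_cons h1 hc, Complex.im_sum]
      refine Finset.sum_eq_zero fun i _ => ?_
      have h2 := ih _ (by simp at hn ⊢; omega) (w.take i) rfl
      have h3 := ih _ (by simp at hn ⊢; omega) (w.drop (i + 1)) rfl
      rw [Complex.mul_im, h3, mul_zero, zero_add, Complex.mul_im, h2]
      split_ifs <;> simp

theorem isCircularMoment_circMoment (hφ : IsFaithfulTracialState φ) (hc : IsCircular φ c) :
    IsCircularMoment (circMoment φ c) := by
  constructor
  · simp [circMoment, hφ.map_one]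
  · intro b w
    have := apply_word_cons hφ.map_one hc b w
    simp only [apply_word hφ.map_one hc] at this
    apply Complex.ofReal_injective
    rw [this]
    push_cast
    refine Finset.sum_congr rfl fun i _ => ?_
    split_ifs <;> simp
  · intro u v
    simp only [circMoment, List.map_append, List.prod_append]
    rw [hφ.tracial]

theorem apply_word_mul_pow_succ (φ : A →ₚ[ℂ] ℂ) (c : A) (K : ℕ) (a b : ℕ → ℂ) (j : ℕ)
    (w : List Bool) :
    φ ((w.map (circLetter c)).prod * (holPoly c K a * star (holPoly c K b)) ^ (j + 1)) =
      ∑ n ∈ Finset.range K, ∑ k ∈ Finset.range K, a n * star (b k) *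
        φ (((w ++ List.replicate n true ++ List.replicate k false).map (circLetter c)).prod *
          (holPoly c K a * star (holPoly c K b)) ^ j) := by
  set X := (holPoly c K a * star (holPoly c K b)) ^ j with hX
  have hmul : holPoly c K a * star (holPoly c K b) = ∑ n ∈ Finset.range K,
      ∑ k ∈ Finset.range K, (a n * star (b k)) • (c ^ n * star c ^ k) := by
    rw [star_holPoly, holPoly, Finset.sum_mul_sum]
    simp only [smul_mul_smul_comm]
  rw [pow_succ', ← hX, ← mul_assoc, hmul, Finset.mul_sum, Finset.sum_mul, map_sum]
  refine Finset.sum_congr rfl fun n _ => ?_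
  rw [Finset.mul_sum, Finset.sum_mul, map_sum]
  refine Finset.sum_congr rfl fun k _ => ?_
  rw [mul_smul_comm, smul_mul_assoc, map_smul, smul_eq_mul, word_append_runs]

theorem apply_word_mul_pow (hφ : IsFaithfulTracialState φ) (hc : IsCircular φ c) (K : ℕ)
    (u v : ℕ → ℝ) (j : ℕ) (w : List Bool) :
    φ ((w.map (circLetter c)).prod *
      (holPoly c K (fun n => (u n : ℂ)) * star (holPoly c K (fun n => (v n : ℂ)))) ^ j) =
      weightedRunSum (circMoment φ c) K u v j w := by
  induction j generalizing w with
  | zero => rw [pow_zero, mul_one, apply_word hφ.map_one hc, weightedRunSum]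
  | succ j ih =>
    rw [apply_word_mul_pow_succ, weightedRunSum]
    push_cast
    simp only [ih, Complex.conj_ofReal, Complex.star_def]

theorem apply_pow_holPoly (hφ : IsFaithfulTracialState φ) (hc : IsCircular φ c) (K : ℕ)
    (u v : ℕ → ℝ) (j : ℕ) :
    φ ((holPoly c K (fun n => (u n : ℂ)) * star (holPoly c K (fun n => (v n : ℂ)))) ^ j) =
      weightedRunSum (circMoment φ c) K u v j [] := by
  simpa using apply_word_mul_pow hφ hc K u v j []

theorem norm_apply_word_mul_pow_le (hφ : IsFaithfulTracialState φ) (hc : IsCircular φ c) (K : ℕ)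
    (a : ℕ → ℂ) (j : ℕ) (w : List Bool) :
    ‖φ ((w.map (circLetter c)).prod * (holPoly c K a * star (holPoly c K a)) ^ j)‖ ≤
      weightedRunSum (circMoment φ c) K (fun n => ‖a n‖) (fun n => ‖a n‖) j w := by
  induction j generalizing w with
  | zero =>
    rw [pow_zero, mul_one, apply_word hφ.map_one hc, weightedRunSum, Complex.norm_real,
      Real.norm_of_nonneg ((isCircularMoment_circMoment hφ hc).nonneg w)]
  | succ j ih =>
    rw [apply_word_mul_pow_succ, weightedRunSum]
    refine (norm_sum_le _ _).trans (Finset.sum_le_sum fun n _ => ?_)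
    refine (norm_sum_le _ _).trans (Finset.sum_le_sum fun k _ => ?_)
    rw [norm_mul, norm_mul, norm_star]
    exact mul_le_mul_of_nonneg_left (ih _) (by positivity)

theorem apply_star_mul_self_pow (hφ : IsFaithfulTracialState φ) (x : A) (q : ℕ) :
    φ ((star x * x) ^ q) = φ ((x * star x) ^ q) := by
  rcases q with _ | q
  · simp
  · rw [pow_succ, ← mul_assoc, mul_pow_mul, mul_assoc, hφ.tracial, mul_assoc, ← pow_succ]

theorem apply_pow_mul_star_pow (hφ : IsFaithfulTracialState φ) (hc : IsCircular φ c) (n k : ℕ) :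
    φ (c ^ n * star c ^ k) = if n = k then 1 else 0 := by
  have h1 := apply_word hφ.map_one hc (List.replicate n true ++ List.replicate k false)
  rw [(isCircularMoment_circMoment hφ hc).true_false] at h1
  rw [List.map_append, List.prod_append, List.map_replicate, List.map_replicate,
    List.prod_replicate, List.prod_replicate] at h1
  refine h1.trans ?_
  split_ifs <;> simp

theorem apply_holPoly_mul_star (hφ : IsFaithfulTracialState φ) (hc : IsCircular φ c) (K : ℕ)
    (a : ℕ → ℂ) :
    φ (holPoly c K a * star (holPoly c K a)) = ∑ n ∈ Finset.range K, (‖a n‖ ^ 2 : ℝ) := by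
  rw [star_holPoly, holPoly, Finset.sum_mul_sum, map_sum]
  push_cast
  refine Finset.sum_congr rfl fun n hn => ?_
  simp only [map_sum, smul_mul_smul_comm, map_smul, smul_eq_mul, apply_pow_mul_star_pow hφ hc]
  simp only [mul_ite, mul_one, mul_zero, Finset.sum_ite_eq, hn, if_true]
  rw [Complex.star_def, Complex.mul_conj, Complex.normSq_eq_norm_sq]
  push_cast
  rfl

variable [StarOrderedRing A]

theorem apply_star (φ : A →ₚ[ℂ] ℂ) (x : A) : φ (star x) = star (φ x) := map_star φ x

/-- The two sums in the arithmetic-geometric mean bound agree: they are the traces of powers of two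
operators which are adjoint to each other. -/
theorem weightedRunSum_comm (hφ : IsFaithfulTracialState φ) (hc : IsCircular φ c) (K : ℕ)
    (u v : ℕ → ℝ) (j : ℕ) :
    weightedRunSum (circMoment φ c) K u v j [] = weightedRunSum (circMoment φ c) K v u j [] := by
  have h1 := apply_pow_holPoly hφ hc K u v j
  have h2 := apply_pow_holPoly hφ hc K v u j
  have h3 := apply_star φ ((holPoly c K (fun n => (u n : ℂ)) *
    star (holPoly c K (fun n => (v n : ℂ)))) ^ j)
  rw [star_pow, star_mul, star_star, h1, h2, Complex.star_def, Complex.conj_ofReal] at h3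
  exact_mod_cast h3.symm

theorem apply_pow_re_le (hφ : IsFaithfulTracialState φ) (hc : IsCircular φ c) (K : ℕ) (a : ℕ → ℂ)
    (j : ℕ) :
    (φ ((holPoly c K a * star (holPoly c K a)) ^ j)).re ≤
      weightedRunSum (circMoment φ c) K (fun n => ‖a n‖ ^ 2) (fun _ => 1) j [] := by
  have h1 := norm_apply_word_mul_pow_le hφ hc K a j []
  have h2 := weightedRunSum_amgm (isCircularMoment_circMoment hφ hc) K (fun n => ‖a n‖)
    (fun n => ‖a n‖) j [] 1 1
  rw [weightedRunSum_comm hφ hc K (fun _ => 1)] at h2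
  rw [List.map_nil, List.prod_nil, one_mul] at h1
  have h3 := Complex.re_le_norm (φ ((holPoly c K a * star (holPoly c K a)) ^ j))
  linarith

theorem apply_abs_pow (hφ : IsFaithfulTracialState φ) (x : A) (q : ℕ) :
    φ (CFC.abs x ^ (2 * q)) = φ ((x * star x) ^ q) := by
  rw [pow_mul, CFC.abs_sq, apply_star_mul_self_pow hφ]

theorem apply_pow_nonneg (φ : A →ₚ[ℂ] ℂ) (x : A) (q : ℕ) : 0 ≤ (φ ((x * star x) ^ q)).re := by
  have : 0 ≤ (x * star x) ^ q := CStarAlgebra.pow_nonneg (mul_star_self_nonneg x) q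
  exact (Complex.le_def.1 (φ.map_nonneg this)).1

theorem traceNorm_nonneg (φ : A →ₚ[ℂ] ℂ) (p : ℕ) (x : A) : 0 ≤ traceNorm φ p x := by
  have : 0 ≤ CFC.abs x ^ p := CStarAlgebra.pow_nonneg (CFC.abs_nonneg x) p
  exact Real.rpow_nonneg (Complex.le_def.1 (φ.map_nonneg this)).1 _

theorem traceNorm_pow (hφ : IsFaithfulTracialState φ) {q : ℕ} (hq : q ≠ 0) (x : A) :
    traceNorm φ (2 * q) x ^ (2 * q) = (φ ((x * star x) ^ q)).re := by
  rw [traceNorm, apply_abs_pow hφ, one_div, Real.rpow_inv_natCast_pow (apply_pow_nonneg φ x q)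
    (by omega)]

end PolynomialTraces

/-- The `L^p`-norm of the dilation of a polynomial in a circular element. -/
theorem exists_traceNorm_le (m : ℕ) : ∃ C : ℝ, 0 < C ∧
    ∀ (A : Type*) [CStarAlgebra A] [PartialOrder A] [StarOrderedRing A] (φ : A →ₚ[ℂ] ℂ) (c : A),
      IsFaithfulTracialState φ → IsCircular φ c → ∀ t : ℝ, 0 < t → t < 1 →
        ∀ (K : ℕ) (a : ℕ → ℂ),
          traceNorm φ (2 * (m + 1)) (holPoly c K fun n => (Real.exp (-(n * t)) : ℂ) * a n) ^
            (2 * (m + 1)) ≤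
          C * (1 / t) ^ (2 * m) * (∑ n ∈ Finset.range K, ‖a n‖ ^ 2) ^ (m + 1) := by
  obtain ⟨C, hC, hb⟩ := exists_weightedRunSum_le m
  refine ⟨C, hC, fun A _ _ _ φ c hφ hc t ht ht1 K a => ?_⟩
  rw [traceNorm_pow hφ (Nat.succ_ne_zero m)]
  refine (apply_pow_re_le hφ hc K _ (m + 1)).trans ?_
  have := hb _ (isCircularMoment_circMoment hφ hc) t ht ht1 K (fun n => ‖a n‖)
  refine le_trans (le_of_eq ?_) this
  congr 1
  funext n
  rw [norm_mul, Complex.norm_real, Real.norm_of_nonneg (Real.exp_pos _).le]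

/-! ### Lower semicontinuity of the `p`-norm -/

section Klein

/-- A convex sequence lies above its tangent at the right end point. -/
theorem convex_seq_tangent {h : ℕ → ℝ} (q : ℕ)
    (hh : ∀ i, i + 1 ≤ q → 2 * h (i + 1) ≤ h (i + 2) + h i) :
    (q + 1) * h q ≤ q * h (q + 1) + h 0 := by
  induction q with
  | zero => simp
  | succ q ih =>
    have h1 := ih fun i hi => hh i (by omega)
    have h2 := mul_le_mul_of_nonneg_left (hh q le_rfl) (show (0 : ℝ) ≤ q + 1 by positivity)
    push_cast
    linarith

variable {A : Type*} [CStarAlgebra A] [PartialOrder A] [StarOrderedRing A] {φ : A →ₚ[ℂ] ℂ}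

theorem apply_star_mul_self_nonneg (φ : A →ₚ[ℂ] ℂ) (x : A) : 0 ≤ (φ (star x * x)).re :=
  (Complex.le_def.1 (φ.map_nonneg (star_mul_self_nonneg x))).1

theorem apply_star_re (φ : A →ₚ[ℂ] ℂ) (x : A) : (φ (star x)).re = (φ x).re := by
  rw [apply_star]; simp

/-- Convexity of `i ↦ φ (a ^ (2 * i) * b ^ (2 * (N - i)))`: the second difference is the trace of
the square of the absolute value of `a ^ (j + 2) * b ^ k - a ^ j * b ^ (k + 2)`. -/
theorem two_mul_apply_le (hφ : IsFaithfulTracialState φ) {a b : A} (ha : IsSelfAdjoint a)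
    (hb : IsSelfAdjoint b) (j k : ℕ) :
    2 * (φ (a ^ (2 * (j + 1)) * b ^ (2 * (k + 1)))).re ≤
      (φ (a ^ (2 * (j + 2)) * b ^ (2 * k))).re + (φ (a ^ (2 * j) * b ^ (2 * (k + 2)))).re := by
  have h := apply_star_mul_self_nonneg φ (a ^ (j + 2) * b ^ k - a ^ j * b ^ (k + 2))
  have hst : star (a ^ (j + 2) * b ^ k - a ^ j * b ^ (k + 2)) =
      b ^ k * a ^ (j + 2) - b ^ (k + 2) * a ^ j := by
    simp only [star_sub, star_mul, star_pow, ha.star_eq, hb.star_eq]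
  have hcyc : ∀ i l i' l' : ℕ, φ ((b ^ l * a ^ i) * (a ^ i' * b ^ l')) =
      φ (a ^ (i + i') * b ^ (l' + l)) := by
    intro i l i' l'
    rw [mul_assoc, hφ.tracial, ← mul_assoc, ← pow_add, mul_assoc, ← pow_add]
  rw [hst, sub_mul, mul_sub, mul_sub] at h
  simp only [map_sub, hcyc, Complex.sub_re] at h
  rw [show j + 2 + (j + 2) = 2 * (j + 2) by ring, show k + k = 2 * k by ring,
    show j + 2 + j = 2 * (j + 1) by ring, show k + 2 + k = 2 * (k + 1) by ring,
    show j + (j + 2) = 2 * (j + 1) by ring, show k + (k + 2) = 2 * (k + 1) by ring,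
    show j + j = 2 * j by ring, show k + 2 + (k + 2) = 2 * (k + 2) by ring] at h
  linarith

/-- Klein's inequality for the convex function `x ↦ x ^ (q + 1)`. -/
theorem klein_pow (hφ : IsFaithfulTracialState φ) {a b : A} (ha : IsSelfAdjoint a)
    (hb : IsSelfAdjoint b) (q : ℕ) :
    (q + 1) * (φ (a ^ (2 * q) * b ^ 2)).re ≤
      q * (φ (a ^ (2 * (q + 1)))).re + (φ (b ^ (2 * (q + 1)))).re := by
  have := convex_seq_tangent (h := fun i => (φ (a ^ (2 * i) * b ^ (2 * (q + 1 - i)))).re) q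
    fun i hi => by
      obtain ⟨k, rfl⟩ := Nat.exists_eq_add_of_le hi
      have := two_mul_apply_le hφ ha hb i k
      rw [show i + 1 + k + 1 - (i + 1) = k + 1 by omega,
        show i + 1 + k + 1 - (i + 2) = k by omega, show i + 1 + k + 1 - i = k + 2 by omega]
      exact this
  simpa using this

/-- A lower bound for `φ ((x * star x) ^ (q + 1))` by a functional which is affine in `x` and exact
at `x = y`. -/
theorem affine_le_apply_pow (hφ : IsFaithfulTracialState φ) (x y : A) (q : ℕ) :
    (q + 1) * (2 * (φ (star y * (y * star y) ^ q * x)).re - (φ ((y * star y) ^ (q + 1))).re) -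
      q * (φ ((y * star y) ^ (q + 1))).re ≤ (φ ((x * star x) ^ (q + 1))).re := by
  set a := CFC.abs (star y) with ha
  set b := CFC.abs (star x) with hb
  have hasa : IsSelfAdjoint a := IsSelfAdjoint.of_nonneg (CFC.abs_nonneg _)
  have hbsa : IsSelfAdjoint b := IsSelfAdjoint.of_nonneg (CFC.abs_nonneg _)
  have ha2 : a ^ 2 = y * star y := by rw [ha, CFC.abs_sq, star_star]
  have hb2 : b ^ 2 = x * star x := by rw [hb, CFC.abs_sq, star_star]
  have h1 := klein_pow hφ hasa hbsa q
  rw [pow_mul, pow_mul, pow_mul, ha2, hb2] at h1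
  have h2 := apply_star_mul_self_nonneg φ (a ^ q * (x - y))
  have haq : a ^ q * a ^ q = (y * star y) ^ q := by rw [← pow_add, ← two_mul, pow_mul, ha2]
  have hYsa : star ((y * star y) ^ q) = (y * star y) ^ q := by simp [star_pow]
  have hexp : star (a ^ q * (x - y)) * (a ^ q * (x - y)) =
      star x * (y * star y) ^ q * x - star x * (y * star y) ^ q * y -
        star y * (y * star y) ^ q * x + star y * (y * star y) ^ q * y := by
    rw [star_mul, star_pow, hasa.star_eq, mul_assoc, ← mul_assoc (a ^ q) (a ^ q), haq, star_sub]
    noncomm_ring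
  have h3 : φ (star x * (y * star y) ^ q * x) = φ ((y * star y) ^ q * (x * star x)) := by
    rw [hφ.tracial, ← mul_assoc, hφ.tracial]
  have h4 : φ (star y * (y * star y) ^ q * y) = φ ((y * star y) ^ (q + 1)) := by
    rw [hφ.tracial, ← mul_assoc, ← pow_succ']
  have h5 : (φ (star x * (y * star y) ^ q * y)).re = (φ (star y * (y * star y) ^ q * x)).re := by
    rw [← apply_star_re φ (star y * (y * star y) ^ q * x), star_mul, star_mul, star_star, hYsa,
      mul_assoc]
  rw [hexp, map_add, map_sub, map_sub, h3, h4] at h2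
  simp only [Complex.add_re, Complex.sub_re, h5] at h2
  have h6 := mul_le_mul_of_nonneg_left (show 2 * (φ (star y * (y * star y) ^ q * x)).re -
    (φ ((y * star y) ^ (q + 1))).re ≤ (φ ((y * star y) ^ q * (x * star x))).re by linarith)
    (show (0 : ℝ) ≤ q + 1 by positivity)
  linarith

theorem inner_toL2 (φ : A →ₚ[ℂ] ℂ) (x y : A) :
    inner ℂ (toL2 φ x) (toL2 φ y) = φ (star x * y) := by
  change inner ℂ ((φ.toPreGNS x : φ.PreGNS) : φ.GNS) ((φ.toPreGNS y : φ.PreGNS) : φ.GNS) = _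
  rw [UniformSpace.Completion.inner_coe]
  rfl

/-- The `p`-norm of an element of `A` is at most any of its values as an element of `L^p`. -/
theorem traceNorm_le_of_hasLpNorm (hφ : IsFaithfulTracialState φ) (q : ℕ) {y : A} {r : ℝ}
    (h : HasLpNorm φ (2 * (q + 1)) (toL2 φ y) r) : traceNorm φ (2 * (q + 1)) y ≤ r := by
  obtain ⟨x, hx, -, hr⟩ := h
  have hr0 : 0 ≤ r := ge_of_tendsto' hr fun n => traceNorm_nonneg _ _ _
  have hlim : Filter.Tendsto (fun n => (φ (star y * (y * star y) ^ q * x n)).re) Filter.atTop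
      (𝓝 (φ ((y * star y) ^ (q + 1))).re) := by
    have h1 : ∀ z, φ (star y * (y * star y) ^ q * z) =
        inner ℂ (toL2 φ (star (star y * (y * star y) ^ q))) (toL2 φ z) := fun z => by
      rw [inner_toL2, star_star]
    have h2 : φ ((y * star y) ^ (q + 1)) = φ (star y * (y * star y) ^ q * y) := by
      rw [hφ.tracial (star y * _), ← mul_assoc, ← pow_succ']
    rw [h2]
    simp only [h1]
    exact (Complex.continuous_re.tendsto _).comp (Filter.Tendsto.inner tendsto_const_nhds hx)
  have hle := le_of_tendsto_of_tendsto' (((hlim.const_mul 2).sub_const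
    (φ ((y * star y) ^ (q + 1))).re).const_mul ((q : ℝ) + 1) |>.sub_const
      (q * (φ ((y * star y) ^ (q + 1))).re)) (hr.pow (2 * (q + 1))) (fun n => by
    rw [traceNorm_pow hφ (Nat.succ_ne_zero q)]
    exact affine_le_apply_pow hφ (x n) y q)
  rw [← pow_le_pow_iff_left₀ (traceNorm_nonneg _ _ _) hr0 (show 2 * (q + 1) ≠ 0 by omega),
    traceNorm_pow hφ (Nat.succ_ne_zero q)]
  linarith

theorem le_ncLpNorm_toL2 (hφ : IsFaithfulTracialState φ) (q : ℕ) (y : A) :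
    ENNReal.ofReal (traceNorm φ (2 * (q + 1)) y) ≤ ncLpNorm φ (2 * (q + 1)) (toL2 φ y) :=
  le_iInf₂ fun _ h => ENNReal.ofReal_le_ofReal (traceNorm_le_of_hasLpNorm hφ q h)

end Klein

/-! ### The holomorphic space and the dilation semigroup -/

/-- For `t > 0` the operator is the norm convergent sum of the rank one operators
`e^{-nt} ⟪v n, ·⟫ v n`. -/
theorem Orthonormal.exists_diagonal_exp {H : Type*} [NormedAddCommGroup H] [InnerProductSpace ℂ H]
    [CompleteSpace H] {v : ℕ → H} (hv : Orthonormal ℂ v) {t : ℝ} (ht : 0 ≤ t) :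
    ∃ D : H →L[ℂ] H, ∀ n : ℕ, D (v n) = ((Real.exp (-(n * t)) : ℝ) : ℂ) • v n := by
  rcases ht.eq_or_lt with rfl | ht
  · exact ⟨ContinuousLinearMap.id ℂ _, fun n => by simp⟩
  · set f : ℕ → (H →L[ℂ] H) := fun n =>
      ((Real.exp (-(n * t)) : ℝ) : ℂ) • (innerSL ℂ (v n)).smulRight (v n) with hf
    have hsum : Summable f := by
      refine Summable.of_norm_bounded (g := fun n : ℕ => Real.exp (-t) ^ n)
        (summable_geometric_of_lt_one (Real.exp_pos _).le (by simpa using ht))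
        fun n => ?_
      rw [hf, norm_smul, ContinuousLinearMap.norm_smulRight_apply, innerSL_apply_norm,
        hv.1 n, Complex.norm_real, Real.norm_of_nonneg (Real.exp_pos _).le, ← Real.exp_nat_mul]
      simp
    refine ⟨∑' n, f n, fun k => ?_⟩
    change ContinuousLinearMap.apply ℂ H (v k) (∑' n, f n) = _
    rw [ContinuousLinearMap.map_tsum _ hsum, tsum_eq_single k]
    · simp [hf, hv.1 k]
    · intro n hn
      simp [hf, hv.2 hn]

section Holomorphic

variable {A : Type*} [CStarAlgebra A] [PartialOrder A] [StarOrderedRing A] {φ : A →ₚ[ℂ] ℂ} {c : A}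

instance completeSpace_L2hol : CompleteSpace (L2hol φ c) :=
  (Submodule.isClosed_topologicalClosure _).completeSpace_coe

theorem orthonormal_holPow (hφ : IsFaithfulTracialState φ) (hc : IsCircular φ c) :
    Orthonormal ℂ (holPow φ c) := by
  classical
  rw [orthonormal_iff_ite]
  intro n k
  change inner ℂ (toL2 φ (c ^ n)) (toL2 φ (c ^ k)) = _
  rw [inner_toL2, hφ.tracial, star_pow, apply_pow_mul_star_pow hφ hc]
  simp only [eq_comm]

theorem dense_span_holPow : Dense (Submodule.span ℂ (Set.range (holPow φ c)) : Set (L2hol φ c)) := by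
  have hmap : (Subalgebra.toSubmodule (Algebra.adjoin ℂ {c})).map (toL2 φ) =
      (Submodule.span ℂ (Set.range (holPow φ c))).map (L2hol φ c).subtype := by
    rw [Algebra.adjoin_eq_span, Submodule.map_span, Submodule.map_span]
    congr 1
    ext ξ
    simp only [Set.mem_image, SetLike.mem_coe, Submonoid.mem_closure_singleton, Set.mem_range]
    constructor
    · rintro ⟨_, ⟨n, rfl⟩, rfl⟩
      exact ⟨_, ⟨n, rfl⟩, rfl⟩
    · rintro ⟨_, ⟨n, rfl⟩, rfl⟩
      exact ⟨_, ⟨n, rfl⟩, rfl⟩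
  intro T
  rw [closure_subtype]
  have h1 : (T : φ.GNS) ∈ closure
      (((Subalgebra.toSubmodule (Algebra.adjoin ℂ {c})).map (toL2 φ) : Submodule ℂ φ.GNS) :
        Set φ.GNS) := T.2
  rw [hmap] at h1
  exact h1

theorem isDilation_unique {t : ℝ} {D D' : L2hol φ c →L[ℂ] L2hol φ c} (hD : IsDilation φ c t D)
    (hD' : IsDilation φ c t D') : D = D' :=
  ContinuousLinearMap.ext_on dense_span_holPow (by
    rintro _ ⟨n, rfl⟩
    rw [hD n, hD' n])

theorem exists_isDilation (hφ : IsFaithfulTracialState φ) (hc : IsCircular φ c) {t : ℝ}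
    (ht : 0 ≤ t) : ∃ D : L2hol φ c →L[ℂ] L2hol φ c, IsDilation φ c t D :=
  (orthonormal_holPow hφ hc).exists_diagonal_exp ht

theorem dilation_sum {t : ℝ} {D : L2hol φ c →L[ℂ] L2hol φ c} (hD : IsDilation φ c t D) (K : ℕ)
    (a : ℕ → ℂ) : (D (∑ n ∈ Finset.range K, a n • holPow φ c n) : φ.GNS) =
      toL2 φ (holPoly c K fun n => ((Real.exp (-(n * t)) : ℝ) : ℂ) * a n) := by
  rw [map_sum, holPoly, map_sum, Submodule.coe_sum]
  refine Finset.sum_congr rfl fun n _ => ?_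
  rw [map_smul, hD n, smul_smul, map_smul, mul_comm]
  rfl

theorem traceNorm_neg (φ : A →ₚ[ℂ] ℂ) (p : ℕ) (x : A) : traceNorm φ p (-x) = traceNorm φ p x := by
  rw [traceNorm, traceNorm, CFC.abs_neg]

/-- If the `p`-norms of dilated polynomials are bounded by the `L²`-norms of the polynomials, then
the same bound holds on the whole holomorphic space. The partial sums of the expansion of `T` are
Cauchy for the `p`-norm, and along a subsequence their `p`-norms converge. -/
theorem ncLpNorm_dilation_le (hφ : IsFaithfulTracialState φ) (hc : IsCircular φ c) {t R : ℝ}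
    (hR : 0 ≤ R) {p : ℕ} {D : L2hol φ c →L[ℂ] L2hol φ c} (hD : IsDilation φ c t D)
    (hb : ∀ (K : ℕ) (a : ℕ → ℂ),
      traceNorm φ p (holPoly c K fun n => ((Real.exp (-(n * t)) : ℝ) : ℂ) * a n) ≤
        R * Real.sqrt (∑ n ∈ Finset.range K, ‖a n‖ ^ 2)) (T : L2hol φ c) :
    ncLpNorm φ p (D T : φ.GNS) ≤ ENNReal.ofReal (R * ‖T‖) := by
  have hon := orthonormal_holPow hφ hc
  have htop : ⊤ ≤ (Submodule.span ℂ (Set.range (holPow φ c))).topologicalClosure :=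
    (Submodule.dense_iff_topologicalClosure_eq_top.1 dense_span_holPow).ge
  set a : ℕ → ℂ := fun n => inner ℂ (holPow φ c n) T with ha
  set x : ℕ → A := fun K => holPoly c K fun n => ((Real.exp (-(n * t)) : ℝ) : ℂ) * a n with hx
  have hT : Filter.Tendsto (fun K => ∑ n ∈ Finset.range K, a n • holPow φ c n) Filter.atTop
      (𝓝 T) := by
    have := ((HilbertBasis.mk hon htop).hasSum_repr T).tendsto_sum_nat
    simpa only [HilbertBasis.repr_apply_apply, HilbertBasis.coe_mk] using this
  have hDT : Filter.Tendsto (fun K => toL2 φ (x K)) Filter.atTop (𝓝 (D T : φ.GNS)) := by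
    have := (continuous_subtype_val.tendsto _).comp ((D.continuous.tendsto T).comp hT)
    refine this.congr fun K => ?_
    exact dilation_sum hD K a
  have hbes : ∀ K, ∑ n ∈ Finset.range K, ‖a n‖ ^ 2 ≤ ‖T‖ ^ 2 := fun K =>
    hon.sum_inner_products_le T
  have hle : ∀ K, traceNorm φ p (x K) ∈ Set.Icc 0 (R * ‖T‖) := fun K => by
    refine ⟨traceNorm_nonneg _ _ _, (hb K a).trans (mul_le_mul_of_nonneg_left ?_ hR)⟩
    exact (Real.sqrt_le_sqrt (hbes K)).trans (Real.sqrt_sq (norm_nonneg T)).le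
  obtain ⟨r, hr, σ, hσ, hlim⟩ := isCompact_Icc.tendsto_subseq hle
  have hcau : CauchySeq fun K => ∑ n ∈ Finset.range K, ‖a n‖ ^ 2 :=
    (hon.inner_products_summable T).hasSum.tendsto_sum_nat.cauchySeq
  have hsub : ∀ N K, N ≤ K → traceNorm φ p (x K - x N) ≤
      R * Real.sqrt |∑ n ∈ Finset.range K, ‖a n‖ ^ 2 - ∑ n ∈ Finset.range N, ‖a n‖ ^ 2| := by
    intro N K hNK
    have h1 : x K - x N = holPoly c K fun n => ((Real.exp (-(n * t)) : ℝ) : ℂ) *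
        (if n < N then 0 else a n) := by
      rw [hx, holPoly_sub c hNK]
      congr 1
      funext n
      split_ifs <;> simp
    have h2 : ∑ n ∈ Finset.range K, ‖if n < N then 0 else a n‖ ^ 2 =
        ∑ n ∈ Finset.range K, ‖a n‖ ^ 2 - ∑ n ∈ Finset.range N, ‖a n‖ ^ 2 := by
      rw [← Finset.sum_Ico_eq_sub _ hNK, ← Finset.sum_subset (s₁ := Finset.Ico N K)]
      · refine Finset.sum_congr rfl fun n hn => ?_
        rw [Finset.mem_Ico] at hn
        rw [if_neg (by omega)]
      · intro n hn; simp at hn ⊢; omega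
      · intro n hn hn'
        simp at hn hn'
        rw [if_pos (by omega)]; simp
    rw [h1, ← h2]
    refine (hb K _).trans (mul_le_mul_of_nonneg_left (Real.sqrt_le_sqrt (le_abs_self _)) hR)
  refine (iInf₂_le r ⟨x ∘ σ, hDT.comp hσ.tendsto_atTop, fun ε hε => ?_, hlim⟩).trans
    (ENNReal.ofReal_le_ofReal hr.2)
  obtain ⟨N, hN⟩ := Metric.cauchySeq_iff.1 hcau ((ε / (R + 1)) ^ 2) (by positivity)
  have hsmall : ∀ K ≥ N, ∀ M ≥ N, M ≤ K → traceNorm φ p (x K - x M) < ε := by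
    intro K hK M hM hMK
    refine (hsub M K hMK).trans_lt ?_
    have h1 := hN K hK M hM
    rw [Real.dist_eq] at h1
    have h2 := Real.sqrt_lt_sqrt (abs_nonneg _) h1
    rw [Real.sqrt_sq (by positivity), lt_div_iff₀ (by positivity)] at h2
    have := Real.sqrt_nonneg
      |∑ n ∈ Finset.range K, ‖a n‖ ^ 2 - ∑ n ∈ Finset.range M, ‖a n‖ ^ 2|
    linarith
  refine ⟨N, fun m hm n hn => ?_⟩
  have hm' := hm.trans (hσ.id_le m)
  have hn' := hn.trans (hσ.id_le n)
  rcases le_total (σ n) (σ m) with h | h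
  · exact hsmall _ hm' _ hn' h
  · rw [← traceNorm_neg, neg_sub]
    exact hsmall _ hn' _ hm' h

/-- The moments of a positive element are log-convex, so that they grow at least geometrically once
they have started to do so. -/
theorem pow_mul_le_apply_pow (φ : A →ₚ[ℂ] ℂ) {X : A} (hX : 0 ≤ X) {ρ : ℝ} (hρ : 0 ≤ ρ)
    (h : ρ * (φ X).re ≤ (φ (X ^ 2)).re) (j : ℕ) : ρ ^ j * (φ X).re ≤ (φ (X ^ (j + 1))).re := by
  have hpos : ∀ j, 0 ≤ (φ (X ^ (j + 2))).re - 2 * ρ * (φ (X ^ (j + 1))).re +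
      ρ ^ 2 * (φ (X ^ j)).re := by
    intro j
    have hsa : star (X - (ρ : ℂ) • (1 : A)) = X - (ρ : ℂ) • (1 : A) := by
      rw [star_sub, star_smul, star_one, (IsSelfAdjoint.of_nonneg hX).star_eq]
      simp
    have h1 := φ.map_nonneg (star_left_conjugate_nonneg (CStarAlgebra.pow_nonneg hX j)
      (X - (ρ : ℂ) • (1 : A)))
    have h2 : star (X - (ρ : ℂ) • (1 : A)) * X ^ j * (X - (ρ : ℂ) • (1 : A)) =
        X ^ (j + 2) - (2 * ρ : ℂ) • X ^ (j + 1) + (ρ ^ 2 : ℂ) • X ^ j := by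
      rw [hsa, sub_mul, mul_sub, sub_mul, smul_one_mul, mul_smul_comm, mul_one, smul_mul_assoc,
        smul_sub, smul_smul, ← pow_succ', ← pow_succ, ← pow_succ, ← sq, two_mul, add_smul]
      abel
    rw [h2, map_add, map_sub, map_smul, map_smul] at h1
    have h3 := (Complex.le_def.1 h1).1
    simpa [← Complex.ofReal_pow, ← Complex.ofReal_ofNat, ← Complex.ofReal_mul] using h3
  have hstep : ∀ j, ρ * (φ (X ^ (j + 1))).re ≤ (φ (X ^ (j + 2))).re := by
    intro j
    induction j with
    | zero => simpa using h
    | succ j ih =>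
      have h1 := hpos (j + 1)
      have h2 := mul_le_mul_of_nonneg_left ih hρ
      rw [show j + 1 + 1 = j + 2 by ring] at h1 ⊢
      linarith
  induction j with
  | zero => simp
  | succ j ih =>
    rw [pow_succ', mul_assoc]
    exact (mul_le_mul_of_nonneg_left ih hρ).trans (hstep j)

end Holomorphic

/-! ### The norm of the dilation semigroup -/

theorem rpow_neg_one_add_pow {t : ℝ} (ht : 0 < t) (m : ℕ) :
    (t ^ (-1 + 2 / ((2 * (m + 1) : ℕ) : ℝ))) ^ (2 * (m + 1)) = (1 / t) ^ (2 * m) := by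
  rw [← Real.rpow_natCast, ← Real.rpow_mul ht.le, one_div, inv_pow, ← Real.rpow_natCast t,
    ← Real.rpow_neg ht.le]
  congr 1
  push_cast
  field_simp
  ring

section Norms

variable {A : Type*} [CStarAlgebra A] [PartialOrder A] [StarOrderedRing A] {φ : A →ₚ[ℂ] ℂ} {c : A}

theorem traceNorm_le_of_pow_le {x : A} {m : ℕ} {C t s : ℝ} (hC : 0 < C) (ht : 0 < t) (hs : 0 ≤ s)
    (h : traceNorm φ (2 * (m + 1)) x ^ (2 * (m + 1)) ≤ C * (1 / t) ^ (2 * m) * s ^ (m + 1)) :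
    traceNorm φ (2 * (m + 1)) x ≤ C ^ (1 / ((2 * (m + 1) : ℕ) : ℝ)) *
      t ^ (-1 + 2 / ((2 * (m + 1) : ℕ) : ℝ)) * Real.sqrt s := by
  rw [← pow_le_pow_iff_left₀ (traceNorm_nonneg _ _ _) (by positivity)
    (show 2 * (m + 1) ≠ 0 by omega), mul_pow, mul_pow, one_div,
    Real.rpow_inv_natCast_pow hC.le (by omega), rpow_neg_one_add_pow ht, pow_mul (Real.sqrt s),
    Real.sq_sqrt hs]
  exact h

theorem norm_sum_holPow_sq (hφ : IsFaithfulTracialState φ) (hc : IsCircular φ c) (K : ℕ)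
    (a : ℕ → ℂ) : ‖∑ n ∈ Finset.range K, a n • holPow φ c n‖ ^ 2 =
      ∑ n ∈ Finset.range K, ‖a n‖ ^ 2 := by
  have h := (orthonormal_holPow hφ hc).inner_sum a a (Finset.range K)
  rw [← inner_self_eq_norm_sq (𝕜 := ℂ), h, map_sum]
  refine Finset.sum_congr rfl fun n _ => ?_
  rw [RCLike.conj_mul]
  norm_cast

/-- The `p`-norm of a multiple of the geometric sum `1 + c + ⋯ + c ^ (3 * L - 1)`. -/
theorem le_traceNorm_geometric (hφ : IsFaithfulTracialState φ) (hc : IsCircular φ c) (m : ℕ)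
    {L : ℕ} (hL : 0 < L) {s : ℝ} :
    s ^ (2 * (m + 1)) * (((L : ℝ) ^ 3 / 3) ^ m * (3 * L)) ≤
      traceNorm φ (2 * (m + 1)) (holPoly c (3 * L) fun _ => (s : ℂ)) ^ (2 * (m + 1)) := by
  set y := holPoly c (3 * L) fun _ => ((1 : ℝ) : ℂ) with hy
  have hsy : holPoly c (3 * L) (fun _ => (s : ℂ)) = (s : ℂ) • y := by
    simp [hy, holPoly, Finset.smul_sum]
  have h1 : (φ (y * star y)).re = 3 * L := by
    rw [hy, apply_holPoly_mul_star hφ hc]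
    simp
  have h2 : (L : ℝ) ^ 4 ≤ (φ ((y * star y) ^ 2)).re := by
    rw [hy, apply_pow_holPoly hφ hc (3 * L) (fun _ => 1) (fun _ => 1), Complex.ofReal_re]
    exact pow_four_le_weightedRunSum (isCircularMoment_circMoment hφ hc) L
  have h3 := pow_mul_le_apply_pow φ (mul_star_self_nonneg y) (ρ := (L : ℝ) ^ 3 / 3)
    (by positivity) (by rw [h1]; refine le_trans (le_of_eq ?_) h2; ring) m
  rw [h1] at h3
  rw [traceNorm_pow hφ (Nat.succ_ne_zero m), hsy]
  have h4 : ((s : ℂ) • y * star ((s : ℂ) • y)) ^ (m + 1) =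
      ((s ^ (2 * (m + 1)) : ℝ) : ℂ) • (y * star y) ^ (m + 1) := by
    rw [star_smul, smul_mul_smul_comm, smul_pow, Complex.star_def, Complex.conj_ofReal]
    congr 1
    push_cast
    rw [pow_mul, sq]
  rw [h4, map_smul, smul_eq_mul, Complex.re_ofReal_mul]
  exact mul_le_mul_of_nonneg_left h3 (by rw [pow_mul]; positivity)

/-- The lower bound is attained, up to a constant, at `∑ e^{nt} c ^ n` with `n` running up to a
multiple of `1 / t`. -/
theorem le_normL2holLp (hφ : IsFaithfulTracialState φ) (hc : IsCircular φ c) (m : ℕ) {t : ℝ}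
    (ht : 0 < t) (ht1 : t < 1) {D : L2hol φ c →L[ℂ] L2hol φ c} (hD : IsDilation φ c t D) :
    ENNReal.ofReal (Real.exp (-3) / 6 * t ^ (-1 + 2 / ((2 * (m + 1) : ℕ) : ℝ))) ≤
      normL2holLp φ c (2 * (m + 1)) D := by
  set L := ⌊1 / t⌋₊ with hLdef
  have h1t : 1 ≤ 1 / t := by rw [le_div_iff₀ ht]; linarith
  have hL : 0 < L := Nat.floor_pos.2 h1t
  have hL1 : (1 : ℝ) ≤ L := by exact_mod_cast hL
  have hLt : (L : ℝ) * t ≤ 1 := by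
    rw [← le_div_iff₀ ht]; exact Nat.floor_le (by positivity)
  have hLt2 : 1 / t ≤ 2 * L := by
    have := Nat.lt_floor_add_one (1 / t)
    linarith
  set s : ℝ := Real.exp (-3) / Real.sqrt (3 * L) with hs
  have hs2 : s ^ 2 * (3 * L) = Real.exp (-3) ^ 2 := by
    rw [hs, div_pow, Real.sq_sqrt (by positivity)]
    field_simp
  set a : ℕ → ℂ := fun n => ((Real.exp (n * t) * s : ℝ) : ℂ) with ha
  set T : L2hol φ c := ∑ n ∈ Finset.range (3 * L), a n • holPow φ c n with hT
  have hTnorm : ‖T‖ ≤ 1 := by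
    rw [← abs_of_nonneg (norm_nonneg T), ← sq_le_one_iff_abs_le_one, hT,
      norm_sum_holPow_sq hφ hc]
    calc ∑ n ∈ Finset.range (3 * L), ‖a n‖ ^ 2
        ≤ ∑ n ∈ Finset.range (3 * L), Real.exp 3 ^ 2 * s ^ 2 := by
          refine Finset.sum_le_sum fun n hn => ?_
          rw [Finset.mem_range] at hn
          have hn' : (n : ℝ) ≤ 3 * L := by exact_mod_cast hn.le
          rw [ha, Complex.norm_real, Real.norm_eq_abs, sq_abs, mul_pow]
          gcongr
          nlinarith
      _ = Real.exp 3 ^ 2 * (s ^ 2 * (3 * L)) := by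
          rw [Finset.sum_const, Finset.card_range, nsmul_eq_mul]
          push_cast
          ring
      _ = 1 := by
          rw [hs2, ← mul_pow, ← Real.exp_add]
          simp
  have hDT : (D T : φ.GNS) = toL2 φ (holPoly c (3 * L) fun _ => (s : ℂ)) := by
    rw [hT, dilation_sum hD]
    congr 2
    funext n
    rw [ha, ← Complex.ofReal_mul, ← mul_assoc, ← Real.exp_add]
    simp
  refine le_trans ?_ (le_iSup₂_of_le T hTnorm le_rfl)
  rw [hDT]
  refine le_trans (ENNReal.ofReal_le_ofReal ?_) (le_ncLpNorm_toL2 hφ m _)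
  rw [← pow_le_pow_iff_left₀ (by positivity) (traceNorm_nonneg _ _ _)
    (show 2 * (m + 1) ≠ 0 by omega), mul_pow, rpow_neg_one_add_pow ht]
  refine le_trans ?_ (le_traceNorm_geometric hφ hc m hL)
  have h5 : s ^ (2 * (m + 1)) * (((L : ℝ) ^ 3 / 3) ^ m * (3 * L)) =
      Real.exp (-3) ^ (2 * (m + 1)) * ((L : ℝ) / 3) ^ (2 * m) := by
    rw [pow_mul s, pow_mul (Real.exp (-3)), ← hs2, mul_pow (s ^ 2), mul_assoc]
    congr 1
    rw [pow_mul, pow_succ (3 * (L : ℝ)), mul_comm ((3 * (L : ℝ)) ^ m), mul_assoc, ← mul_pow,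
      mul_comm]
    congr 2
    field_simp
  rw [h5, div_pow, div_mul_eq_mul_div, mul_div_assoc]
  refine mul_le_mul_of_nonneg_left ?_ (by positivity)
  rw [div_le_iff₀ (by positivity)]
  calc (1 / t) ^ (2 * m) ≤ (2 * L) ^ (2 * m) := by gcongr
    _ = ((L : ℝ) / 3) ^ (2 * m) * 6 ^ (2 * m) := by rw [← mul_pow]; congr 1; ring
    _ ≤ ((L : ℝ) / 3) ^ (2 * m) * 6 ^ (2 * (m + 1)) := by
        gcongr <;> norm_num

end Norms

theorem mainTheorem5 (p : ℕ) (hp : Even p) (hp4 : 4 ≤ p) :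
    ∃ α β : ℝ, 0 < α ∧ 0 < β ∧
      ∀ (A : Type*) [CStarAlgebra A] [PartialOrder A] [StarOrderedRing A]
        (φ : A →ₚ[ℂ] ℂ), IsFaithfulTracialState φ →
      ∀ c : A, IsCircular φ c →
        (∀ t : ℝ, 0 ≤ t → ∃! D : L2hol φ c →L[ℂ] L2hol φ c, IsDilation φ c t D) ∧
        ∀ t : ℝ, 0 < t → t < 1 →
          ∀ D : L2hol φ c →L[ℂ] L2hol φ c, IsDilation φ c t D →
            (∀ T : L2hol φ c,
              ncLpNorm φ p (D T : φ.GNS) ≤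
                ENNReal.ofReal (β * t ^ (-1 + 2 / (p : ℝ)) * ‖T‖)) ∧
            ENNReal.ofReal (α * t ^ (-1 + 2 / (p : ℝ))) ≤ normL2holLp φ c p D ∧
            normL2holLp φ c p D ≤ ENNReal.ofReal (β * t ^ (-1 + 2 / (p : ℝ))) := by
  obtain ⟨m, rfl⟩ : ∃ m, p = 2 * (m + 1) := by
    obtain ⟨k, rfl⟩ := hp
    exact ⟨k - 1, by omega⟩
  obtain ⟨C, hC, hb⟩ := exists_traceNorm_le m
  refine ⟨Real.exp (-3) / 6, C ^ (1 / ((2 * (m + 1) : ℕ) : ℝ)), by positivity, by positivity,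
    fun A _ _ _ φ hφ c hc => ⟨fun t ht => ?_, fun t ht ht1 D hD => ?_⟩⟩
  · obtain ⟨D, hD⟩ := exists_isDilation hφ hc ht
    exact ⟨D, hD, fun D' hD' => isDilation_unique hD' hD⟩
  · have hupper : ∀ T : L2hol φ c, ncLpNorm φ (2 * (m + 1)) (D T : φ.GNS) ≤
        ENNReal.ofReal (C ^ (1 / ((2 * (m + 1) : ℕ) : ℝ)) *
          t ^ (-1 + 2 / ((2 * (m + 1) : ℕ) : ℝ)) * ‖T‖) :=
      ncLpNorm_dilation_le hφ hc (by positivity) hD fun K a =>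
        traceNorm_le_of_pow_le hC ht (Finset.sum_nonneg fun _ _ => sq_nonneg _)
          (hb A φ c hφ hc t ht ht1 K a)
    refine ⟨hupper, le_normL2holLp hφ hc m ht ht1 hD, iSup₂_le fun T hT => (hupper T).trans ?_⟩
    exact ENNReal.ofReal_le_ofReal (mul_le_of_le_one_right (by positivity) hT)
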